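/- Let $H^n([0,1])=W^{n,2}([0,1])$ denote the Sobolev space of functions on $[0,1]$ whose weak derivatives of order at most $n$ lie in $L^2(0,1)$, let $H^2_0([0,1])$ be the Hilbert space of all $f\in H^2([0,1])$ with $f(0)=f(1)=f'(0)=f'(1)=0$, with inner product $\langle u,v\rangle_{H_0^2}=\int_0^1\partial_{xx}u\,\partial_{xx}v\,dx$, and let $$\mathrm{Diff}_0^2([0,1])=\{\mathrm{Id}+f : f\in H^2_0([0,1]),\ 1+f'(x)>0 \text{ for all } x\in[0,1]\},$$ which is an open subset of the affine space $\mathrm{Id}+H_0^2([0,1])$, endowed with the right-invariant Riemannian metric $$G_\varphi(X,Y)=\langle X\circ\varphi^{-1},Y\circ\varphi^{-1}\rangle_{H_0^2},\qquad X,Y\in T_\varphi\mathrm{Diff}_0^2([0,1])=H_0^2([0,1]).$$ A geodesic is a $C^1$ curve $\varphi:[0,1]\to\mathrm{Diff}_0^2([0,1])$ which is a critical point of the energy $\frac12\int_0^1G_{\varphi(t)}(\dot\varphi(t),\dot\varphi(t))\,dt$ with respect to smooth variations $\varphi+sh$, where $h:\mathbb R\to H_0^2([0,1])$ is smooth with $h(0)=h(1)=0$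 and $s$ is small. Let $n\ge 3$ be an integer and let $\varphi_1\in\mathrm{Diff}_0^2([0,1])$ belong to $H^n([0,1])$. Then for every geodesic $\varphi$ with $\varphi(0)=\mathrm{Id}$ and $\varphi(1)=\varphi_1$, the initial tangent vector $\dot\varphi(0)$ lies in $H^n([0,1])$. -/

import Mathlib

open MeasureTheory Set
open scoped ContDiff

namespace SobolevDiff

noncomputable section

/-- Smooth test functions with compact support in the open interval `(0,1)`. -/
structure IsTest (ψ : ℝ → ℝ) : Prop where
  smooth : ContDiff ℝ ∞ ψ
  compact : HasCompactSupport ψ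
  supp : tsupport ψ ⊆ Ioo 0 1

/-- Lebesgue measure on `(0,1)`. -/
abbrev μI : Measure ℝ := volume.restrict (Ioo 0 1)

/-- `g` is a weak derivative of order `k` of `f` on `(0,1)`. -/
def IsWeakDeriv (k : ℕ) (f g : ℝ → ℝ) : Prop :=
  ∀ ψ : ℝ → ℝ, IsTest ψ →
    ∫ x, f x * iteratedDeriv k ψ x ∂μI = (-1) ^ k * ∫ x, g x * ψ x ∂μI

/-- The Sobolev space `H^n([0,1]) = W^{n,2}([0,1])`: `f` is in `L^2(0,1)` and its weak derivatives
of order at most `n` exist in `L^2(0,1)`. Only the restriction of `f` to `(0,1)` matters. -/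
def MemH (n : ℕ) (f : ℝ → ℝ) : Prop :=
  MemLp f 2 μI ∧ ∀ k ≤ n, ∃ g : ℝ → ℝ, MemLp g 2 μI ∧ IsWeakDeriv k f g

open Classical in
/-- The weak second derivative `∂ₓₓ f`, as an element of `L^2(0,1)`
(and `0` if there is none in `L^2(0,1)`). -/
def weakD2 (f : ℝ → ℝ) : Lp ℝ 2 μI :=
  if h : ∃ g : Lp ℝ 2 μI, IsWeakDeriv 2 f g then h.choose else 0

/-- The bilinear form `⟨u, v⟩ = ∫₀¹ ∂ₓₓ u ∂ₓₓ v dx`. -/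
def innerH02 (u v : ℝ → ℝ) : ℝ := ∫ x, weakD2 u x * weakD2 v x ∂μI

/-! ### Helper facts on test functions and weak derivatives -/

lemma IsTest.iteratedDeriv_cont {ψ : ℝ → ℝ} (h : IsTest ψ) (k : ℕ) :
    Continuous (iteratedDeriv k ψ) :=
  h.smooth.continuous_iteratedDeriv k (by exact_mod_cast le_top)

lemma IsTest.deriv {ψ : ℝ → ℝ} (h : IsTest ψ) : IsTest (deriv ψ) where
  smooth := ((contDiff_infty_iff_deriv).1 h.smooth).2
  compact := h.compact.deriv
  supp := (tsupport_deriv_subset (𝕜 := ℝ)).trans h.supp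

lemma IsTest.iteratedDeriv {ψ : ℝ → ℝ} (h : IsTest ψ) (k : ℕ) : IsTest (iteratedDeriv k ψ) := by
  induction k with
  | zero => simpa using h
  | succ k ih => rw [iteratedDeriv_succ]; exact ih.deriv

lemma IsTest.memLp {ψ : ℝ → ℝ} (h : IsTest ψ) : MemLp ψ 2 μI :=
  (h.smooth.continuous.memLp_of_hasCompactSupport h.compact).restrict _

lemma integrable_mul_test {f ψ : ℝ → ℝ} (hf : MemLp f 2 μI) (h : IsTest ψ) :
    Integrable (fun x => f x * ψ x) μI :=
  hf.integrable_mul h.memLp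

lemma IsWeakDeriv.add {k : ℕ} {f₁ f₂ g₁ g₂ : ℝ → ℝ} (hf₁ : MemLp f₁ 2 μI) (hf₂ : MemLp f₂ 2 μI)
    (hg₁ : MemLp g₁ 2 μI) (hg₂ : MemLp g₂ 2 μI) (h₁ : IsWeakDeriv k f₁ g₁)
    (h₂ : IsWeakDeriv k f₂ g₂) : IsWeakDeriv k (f₁ + f₂) (g₁ + g₂) := by
  intro ψ hψ
  simp only [Pi.add_apply, add_mul]
  rw [integral_add (integrable_mul_test hf₁ (hψ.iteratedDeriv k))
    (integrable_mul_test hf₂ (hψ.iteratedDeriv k)),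
    integral_add (integrable_mul_test hg₁ hψ) (integrable_mul_test hg₂ hψ), h₁ ψ hψ, h₂ ψ hψ]
  ring

lemma IsWeakDeriv.smul {k : ℕ} {f g : ℝ → ℝ} (c : ℝ) (h : IsWeakDeriv k f g) :
    IsWeakDeriv k (c • f) (c • g) := by
  intro ψ hψ
  simp only [Pi.smul_apply, smul_eq_mul, mul_assoc]
  rw [integral_const_mul, integral_const_mul, h ψ hψ]
  ring

lemma IsWeakDeriv.congr {k : ℕ} {f g g' : ℝ → ℝ} (h : IsWeakDeriv k f g) (hg : g =ᵐ[μI] g') :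
    IsWeakDeriv k f g' := by
  intro ψ hψ
  rw [h ψ hψ]
  congr 1
  apply integral_congr_ae
  filter_upwards [hg] with x hx
  rw [hx]

lemma ae_zero_of_test {g : ℝ → ℝ} (hg : MemLp g 2 μI)
    (h : ∀ ψ, IsTest ψ → ∫ x, g x * ψ x ∂μI = 0) : g =ᵐ[μI] 0 := by
  have hi : IntegrableOn g (Ioo 0 1) volume := hg.integrable (by norm_num)
  have key := isOpen_Ioo.ae_eq_zero_of_integral_contDiff_smul_eq_zero
    (μ := volume) (f := g) (U := Ioo (0 : ℝ) 1) hi.locallyIntegrableOn ?_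
  · exact (ae_restrict_iff' measurableSet_Ioo).2 key
  · intro ψ h1 h2 h3
    have := h ψ ⟨h1, h2, h3⟩
    rw [← this, ← integral_indicator measurableSet_Ioo]
    apply integral_congr_ae
    refine Filter.Eventually.of_forall fun x => ?_
    by_cases hx : x ∈ Ioo (0 : ℝ) 1
    · simp [hx, mul_comm]
    · have : ψ x = 0 := image_eq_zero_of_notMem_tsupport fun h => hx (h3 h)
      simp [hx, this]

lemma weakD2_unique {f : ℝ → ℝ} {g₁ g₂ : Lp ℝ 2 μI} (h₁ : IsWeakDeriv 2 f g₁)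
    (h₂ : IsWeakDeriv 2 f g₂) : g₁ = g₂ := by
  have h : ((g₁ - g₂ : Lp ℝ 2 μI) : ℝ → ℝ) =ᵐ[μI] 0 := by
    apply ae_zero_of_test (Lp.memLp _)
    intro ψ hψ
    have e : ∫ x, (g₁ - g₂ : Lp ℝ 2 μI) x * ψ x ∂μI
        = ∫ x, (g₁ x * ψ x - g₂ x * ψ x) ∂μI := by
      apply integral_congr_ae
      filter_upwards [Lp.coeFn_sub g₁ g₂] with x hx
      rw [hx, Pi.sub_apply, sub_mul]
    rw [e, integral_sub (integrable_mul_test (Lp.memLp _) hψ)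
      (integrable_mul_test (Lp.memLp _) hψ)]
    have a := h₁ ψ hψ
    have b := h₂ ψ hψ
    norm_num at a b
    linarith
  have := (Lp.eq_zero_iff_ae_eq_zero).2 h
  exact sub_eq_zero.1 this

lemma weakD2_spec {f : ℝ → ℝ} (hf : MemH 2 f) : IsWeakDeriv 2 f (weakD2 f) := by
  have h : ∃ g : Lp ℝ 2 μI, IsWeakDeriv 2 f g := by
    obtain ⟨g, hg, hw⟩ := hf.2 2 le_rfl
    exact ⟨hg.toLp g, hw.congr hg.coeFn_toLp.symm⟩
  rw [weakD2, dif_pos h]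
  exact h.choose_spec

lemma weakD2_add {f g : ℝ → ℝ} (hf : MemH 2 f) (hg : MemH 2 g) (hfg : MemH 2 (f + g)) :
    weakD2 (f + g) = weakD2 f + weakD2 g :=
  weakD2_unique (weakD2_spec hfg)
    ((IsWeakDeriv.add hf.1 hg.1 (Lp.memLp _) (Lp.memLp _) (weakD2_spec hf)
      (weakD2_spec hg)).congr (Lp.coeFn_add _ _).symm)

lemma weakD2_smul {f : ℝ → ℝ} (c : ℝ) (hf : MemH 2 f) (hcf : MemH 2 (c • f)) :
    weakD2 (c • f) = c • weakD2 f :=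
  weakD2_unique (weakD2_spec hcf)
    (((weakD2_spec hf).smul c).congr (Lp.coeFn_smul _ _).symm)

lemma MemH.add {n : ℕ} {f g : ℝ → ℝ} (hf : MemH n f) (hg : MemH n g) : MemH n (f + g) := by
  refine ⟨hf.1.add hg.1, fun k hk => ?_⟩
  obtain ⟨a, ha, ha'⟩ := hf.2 k hk
  obtain ⟨b, hb, hb'⟩ := hg.2 k hk
  exact ⟨a + b, ha.add hb, IsWeakDeriv.add hf.1 hg.1 ha hb ha' hb'⟩

lemma MemH.smul {n : ℕ} {f : ℝ → ℝ} (c : ℝ) (hf : MemH n f) : MemH n (c • f) := by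
  refine ⟨hf.1.const_smul c, fun k hk => ?_⟩
  obtain ⟨a, ha, ha'⟩ := hf.2 k hk
  exact ⟨c • a, ha.const_smul c, ha'.smul c⟩

lemma MemH.zero (n : ℕ) : MemH n 0 :=
  ⟨MemLp.zero, fun k _ => ⟨0, MemLp.zero, fun ψ _ => by simp⟩⟩

/-! ### The Hilbert space `H_0^2([0,1])` -/

/-- The linear space `H_0^2([0,1])`: functions in `H^2([0,1])`, given by their `C^1` representative
on `[0,1]`, which vanish at `0` and `1` together with their first derivative. To have one function
on `ℝ` for each function on `[0,1]`, they are extended by `0`. -/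
def h02Submodule : Submodule ℝ (ℝ → ℝ) where
  carrier := {f | MemH 2 f ∧ ContDiffOn ℝ 1 f (Icc 0 1) ∧ f 0 = 0 ∧ f 1 = 0 ∧
    derivWithin f (Icc 0 1) 0 = 0 ∧ derivWithin f (Icc 0 1) 1 = 0 ∧ ∀ x ∉ Icc (0 : ℝ) 1, f x = 0}
  zero_mem' := by
    refine ⟨MemH.zero 2, contDiffOn_const, rfl, rfl, ?_, ?_, fun _ _ => rfl⟩ <;> simp
  add_mem' := by
    rintro f g ⟨f1, f2, f3, f4, f5, f6, f7⟩ ⟨g1, g2, g3, g4, g5, g6, g7⟩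
    refine ⟨f1.add g1, f2.add g2, by simp [f3, g3], by simp [f4, g4], ?_, ?_,
      fun x hx => by simp [f7 x hx, g7 x hx]⟩
    · rw [derivWithin_add (f2.differentiableOn one_ne_zero 0 (by simp))
        (g2.differentiableOn one_ne_zero 0 (by simp)), f5, g5, add_zero]
    · rw [derivWithin_add (f2.differentiableOn one_ne_zero 1 (by simp))
        (g2.differentiableOn one_ne_zero 1 (by simp)), f6, g6, add_zero]
  smul_mem' := by
    rintro c f ⟨f1, f2, f3, f4, f5, f6, f7⟩
    refine ⟨f1.smul c, f2.const_smul c, by simp [f3], by simp [f4], ?_, ?_,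
      fun x hx => by simp [f7 x hx]⟩
    · have := (((f2.differentiableOn one_ne_zero 0 (by simp)).hasDerivWithinAt).const_smul
        c).derivWithin (uniqueDiffOn_Icc zero_lt_one 0 (by simp))
      rw [this, f5, smul_zero]
    · have := (((f2.differentiableOn one_ne_zero 1 (by simp)).hasDerivWithinAt).const_smul
        c).derivWithin (uniqueDiffOn_Icc zero_lt_one 1 (by simp))
      rw [this, f6, smul_zero]

/-- The space `H_0^2([0,1])`. -/
def H02 : Type := h02Submodule

instance : AddCommGroup H02 := inferInstanceAs (AddCommGroup h02Submodule)

instance : Module ℝ H02 := inferInstanceAs (Module ℝ h02Submodule)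

instance : CoeFun H02 (fun _ => ℝ → ℝ) := ⟨fun f => Subtype.val f⟩

lemma H02.prop (f : H02) : MemH 2 f ∧ ContDiffOn ℝ 1 f (Icc 0 1) ∧ f 0 = 0 ∧ f 1 = 0 ∧
    derivWithin f (Icc 0 1) 0 = 0 ∧ derivWithin f (Icc 0 1) 1 = 0 ∧
    ∀ x ∉ Icc (0 : ℝ) 1, f x = 0 := Subtype.property f

/-- The second derivative `H_0^2([0,1]) → L^2(0,1)`. -/
def H02.d2 : H02 →ₗ[ℝ] Lp ℝ 2 μI where
  toFun f := weakD2 f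
  map_add' f g := weakD2_add f.prop.1 g.prop.1 (f + g).prop.1
  map_smul' c f := weakD2_smul c f.prop.1 (c • f).prop.1

/-- A primitive of a test function with zero mean is a test function. -/
lemma exists_primitive {κ : ℝ → ℝ} (hκ : IsTest κ) (h0 : ∫ x in (0 : ℝ)..1, κ x = 0) :
    ∃ ψ, IsTest ψ ∧ deriv ψ = κ := by
  have hc := hκ.smooth.continuous
  have hd : ∀ x, HasDerivAt (fun x => ∫ y in (0 : ℝ)..x, κ y) (κ x) x := fun x =>
    hc.integral_hasStrictDerivAt 0 x |>.hasDerivAt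
  have hd' : _root_.deriv (fun x => ∫ y in (0 : ℝ)..x, κ y) = κ := funext fun x => (hd x).deriv
  obtain ⟨a, b, ha, hb, hab⟩ : ∃ a b : ℝ, 0 < a ∧ b < 1 ∧ tsupport κ ⊆ Icc a b := by
    have hcomp : IsCompact (tsupport κ) := hκ.compact
    rcases (tsupport κ).eq_empty_or_nonempty with he | hne
    · exact ⟨1, 0, one_pos, zero_lt_one, by simp [he]⟩
    · exact ⟨sInf (tsupport κ), sSup (tsupport κ), (hκ.supp (hcomp.sInf_mem hne)).1,
        (hκ.supp (hcomp.sSup_mem hne)).2,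
        fun x hx => ⟨csInf_le hcomp.bddBelow hx, le_csSup hcomp.bddAbove hx⟩⟩
  have hz : ∀ x ∉ Icc a b, κ x = 0 := fun x hx =>
    image_eq_zero_of_notMem_tsupport fun h => hx (hab h)
  have hs : tsupport (fun x => ∫ y in (0 : ℝ)..x, κ y) ⊆ Icc a b := by
    apply closure_minimal _ isClosed_Icc
    intro x hx
    by_contra hn
    apply hx
    rw [mem_Icc, not_and_or, not_le, not_le] at hn
    rcases hn with hn | hn
    · apply intervalIntegral.integral_zero_ae
      refine Filter.Eventually.of_forall fun y hy => hz y fun h => ?_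
      rw [mem_uIoc] at hy
      rcases hy with hy | hy <;> linarith [h.1, hy.1, hy.2]
    · have e : ∫ y in x..(1 : ℝ), κ y = 0 := by
        apply intervalIntegral.integral_zero_ae
        refine Filter.Eventually.of_forall fun y hy => hz y fun h => ?_
        rw [mem_uIoc] at hy
        rcases hy with hy | hy <;> linarith [h.2, hy.1, hy.2]
      have := intervalIntegral.integral_add_adjacent_intervals
        (hc.intervalIntegrable (μ := volume) 0 x) (hc.intervalIntegrable x 1)
      change ∫ y in (0 : ℝ)..x, κ y = 0
      linarith
  refine ⟨fun x => ∫ y in (0 : ℝ)..x, κ y, ⟨?_, ?_, ?_⟩, hd'⟩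
  · rw [contDiff_infty_iff_deriv]
    exact ⟨fun x => (hd x).differentiableAt, by rw [hd']; exact hκ.smooth⟩
  · exact HasCompactSupport.of_support_subset_isCompact isCompact_Icc
      ((subset_tsupport _).trans hs)
  · exact hs.trans fun x hx => ⟨ha.trans_le hx.1, hx.2.trans_lt hb⟩

lemma exists_bump : ∃ ρ, IsTest ρ ∧ ∫ x in (0 : ℝ)..1, ρ x = 1 := by
  let b : ContDiffBump (1 / 2 : ℝ) := ⟨1 / 8, 1 / 4, by norm_num, by norm_num⟩
  refine ⟨b.normed volume, ⟨b.contDiff_normed, b.hasCompactSupport_normed, ?_⟩, ?_⟩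
  · rw [b.tsupport_normed_eq, Real.closedBall_eq_Icc]
    intro x hx
    norm_num [b] at hx
    constructor <;> linarith [hx.1, hx.2]
  · refine Eq.trans ?_ (b.integral_normed (μ := volume))
    rw [intervalIntegral.integral_of_le zero_le_one]
    apply setIntegral_eq_integral_of_forall_compl_eq_zero
    intro x hx
    apply image_eq_zero_of_notMem_tsupport
    rw [b.tsupport_normed_eq, Real.closedBall_eq_Icc]
    intro h
    norm_num [b] at h
    exact hx ⟨by linarith [h.1], by linarith [h.2]⟩

lemma integral_μI (f : ℝ → ℝ) : ∫ x, f x ∂μI = ∫ x in (0 : ℝ)..1, f x := by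
  rw [intervalIntegral.integral_of_le zero_le_one, integral_Ioc_eq_integral_Ioo]

lemma H02.d2_injective : Function.Injective H02.d2 := by
  rw [injective_iff_map_eq_zero]
  intro f hf
  obtain ⟨f1, f2, f3, f4, f5, f6, f7⟩ := f.prop
  set h : ℝ → ℝ := derivWithin f (Icc 0 1) with hh
  have hcont : ContinuousOn h (Icc 0 1) :=
    f2.continuousOn_derivWithin (uniqueDiffOn_Icc zero_lt_one) le_rfl
  have hder : ∀ x ∈ Ioo (0 : ℝ) 1, HasDerivAt f (h x) x := fun x hx =>
    ((f2.differentiableOn one_ne_zero x (Ioo_subset_Icc_self hx)).hasDerivWithinAt).hasDerivAt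
      (Icc_mem_nhds hx.1 hx.2)
  have hint : IntervalIntegrable h volume 0 1 :=
    ContinuousOn.intervalIntegrable (by rwa [uIcc_of_le zero_le_one])
  have hw : IsWeakDeriv 2 f (weakD2 f) := weakD2_spec f1
  have hf' : weakD2 f = 0 := hf
  have step1 : ∀ ψ, IsTest ψ → ∫ x in (0 : ℝ)..1, h x * deriv ψ x = 0 := by
    intro ψ hψ
    have a := hw ψ hψ
    rw [hf'] at a
    have z : ∫ x, (0 : Lp ℝ 2 μI) x * ψ x ∂μI = 0 := by
      rw [← integral_zero ℝ ℝ (μ := μI)]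
      apply integral_congr_ae
      filter_upwards [Lp.coeFn_zero ℝ 2 μI] with x hx
      rw [hx]; simp
    rw [z, mul_zero, integral_μI] at a
    have e := intervalIntegral.integral_mul_deriv_eq_deriv_mul_of_hasDerivAt
      (a := 0) (b := 1) (u := f) (u' := h) (v := deriv ψ) (v' := iteratedDeriv 2 ψ)
      (by rw [uIcc_of_le zero_le_one]; exact f2.continuousOn)
      (hψ.deriv.smooth.continuous.continuousOn)
      (by rw [min_eq_left zero_le_one, max_eq_right zero_le_one]; exact hder)
      (by
        intro x _
        rw [iteratedDeriv_succ, iteratedDeriv_one]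
        exact (hψ.deriv.smooth.differentiable (by simp) x).hasDerivAt)
      hint ((hψ.iteratedDeriv 2).smooth.continuous.intervalIntegrable _ _)
    rw [a, f3, f4] at e
    linarith
  obtain ⟨ρ, hρ, hρ1⟩ := exists_bump
  set c := ∫ x in (0 : ℝ)..1, h x * ρ x with hc
  have hmem : MemLp h 2 μI := by
    obtain ⟨C, hC⟩ := isCompact_Icc.exists_bound_of_continuousOn hcont
    refine MemLp.of_bound ((hcont.mono Ioo_subset_Icc_self).aestronglyMeasurable
      measurableSet_Ioo) C ?_
    exact (ae_restrict_iff' measurableSet_Ioo).2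
      (Filter.Eventually.of_forall fun x hx => hC x (Ioo_subset_Icc_self hx))
  have hae : (fun x => h x - c) =ᵐ[μI] 0 := by
    apply ae_zero_of_test (hmem.sub (memLp_const c))
    intro χ hχ
    have hci : ∀ {θ : ℝ → ℝ}, Continuous θ → IntervalIntegrable (fun x => h x * θ x) volume 0 1 :=
      fun hθ => hint.mul_continuousOn hθ.continuousOn
    have hcθ : Continuous χ := hχ.smooth.continuous
    have hcρ : Continuous ρ := hρ.smooth.continuous
    set m := ∫ x in (0 : ℝ)..1, χ x with hm
    have hκ : IsTest (fun x => χ x - m * ρ x) := by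
      refine ⟨hχ.smooth.sub (contDiff_const.mul hρ.smooth),
        hχ.compact.sub hρ.compact.mul_left, ?_⟩
      refine (tsupport_sub _ _).trans (union_subset hχ.supp ?_)
      exact (tsupport_mul_subset_right).trans hρ.supp
    obtain ⟨ψ, hψ, hψ'⟩ := exists_primitive hκ (by
      rw [intervalIntegral.integral_sub (hcθ.intervalIntegrable _ _)
        ((hcρ.intervalIntegrable _ _).const_mul m),
        intervalIntegral.integral_const_mul, hρ1, ← hm]
      ring)
    have s := step1 ψ hψ
    rw [hψ'] at s
    have e1 : ∫ x in (0 : ℝ)..1, h x * (χ x - m * ρ x)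
        = (∫ x in (0 : ℝ)..1, h x * χ x) - m * c := by
      rw [hc, ← intervalIntegral.integral_const_mul, ← intervalIntegral.integral_sub (hci hcθ)
        ((hci hcρ).const_mul m)]
      congr 1
      funext x
      ring
    have e2 : ∫ x in (0 : ℝ)..1, (h x - c) * χ x
        = (∫ x in (0 : ℝ)..1, h x * χ x) - c * m := by
      rw [hm, ← intervalIntegral.integral_const_mul, ← intervalIntegral.integral_sub (hci hcθ)
        ((hcθ.intervalIntegrable _ _).const_mul c)]
      congr 1
      funext x
      ring
    rw [integral_μI]
    change ∫ x in (0 : ℝ)..1, (h x - c) * χ x = 0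
    rw [e2]
    rw [e1] at s
    linarith
  have hall : EqOn h (fun _ => c) (Icc 0 1) := by
    have : EqOn h (fun _ => c) (Ioo 0 1) := by
      refine Measure.eqOn_open_of_ae_eq (μ := volume) ?_ isOpen_Ioo
        (hcont.mono Ioo_subset_Icc_self) continuousOn_const
      filter_upwards [hae] with x hx
      simpa [sub_eq_zero] using hx
    exact this.of_subset_closure hcont continuousOn_const Ioo_subset_Icc_self
      (by rw [closure_Ioo zero_ne_one])
  have hc0 : c = 0 := (hall (left_mem_Icc.2 zero_le_one)).symm.trans f5
  have hconst : ∀ x ∈ Icc (0 : ℝ) 1, f x = f 0 :=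
    constant_of_derivWithin_zero (f2.differentiableOn one_ne_zero) fun x hx => by
      rw [← hh, hall (Ico_subset_Icc_self hx), hc0]
  apply Subtype.ext
  funext x
  by_cases hx : x ∈ Icc (0 : ℝ) 1
  · exact (hconst x hx).trans f3
  · exact f7 x hx

/-- `H_0^2([0,1])` with the norm `‖f‖ = (∫₀¹ (∂ₓₓ f)² dx)^{1/2}`. -/
instance : NormedAddCommGroup H02 :=
  NormedAddCommGroup.induced H02 (Lp ℝ 2 μI) H02.d2 H02.d2_injective

instance : NormedSpace ℝ H02 := NormedSpace.induced ℝ H02 (Lp ℝ 2 μI) H02.d2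

/-! ### The diffeomorphism group, its right-invariant metric and its geodesics -/

/-- The map `Id + f`. -/
def toMap (f : H02) : ℝ → ℝ := fun x => x + f x

/-- `Diff_0^2([0,1]) = {Id + f | f ∈ H_0^2([0,1]), 1 + f' > 0}`; the diffeomorphism `Id + f` is
encoded by `f`, so that the group is an open subset of the Hilbert space `H_0^2([0,1])` and its
tangent spaces are all equal to `H_0^2([0,1])`. -/
def Diff02 : Set H02 := {f | ∀ x ∈ Icc (0 : ℝ) 1, 0 < 1 + derivWithin f (Icc 0 1) x}

/-- The inverse on `[0,1]` of the diffeomorphism `φ = Id + f`. -/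
def invMap (f : H02) : ℝ → ℝ := Function.invFunOn (toMap f) (Icc 0 1)

/-- The right-invariant metric `G_φ(X, Y) = ⟨X ∘ φ⁻¹, Y ∘ φ⁻¹⟩_{H_0^2}` at `φ = Id + f`. -/
def metricG (f X Y : H02) : ℝ := innerH02 (X ∘ invMap f) (Y ∘ invMap f)

/-- The velocity at time `t` of a curve on the time interval `[0,1]`. -/
def velocity (γ : ℝ → H02) (t : ℝ) : H02 := derivWithin γ (Icc 0 1) t

/-- The energy `½ ∫₀¹ G_{γ(t)}(γ'(t), γ'(t)) dt`. -/
def energy (γ : ℝ → H02) : ℝ :=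
  (1 / 2) * ∫ t in (0 : ℝ)..1, metricG (γ t) (velocity γ t) (velocity γ t)

/-- A geodesic `γ : [0,1] → Diff_0^2([0,1])` of the metric `G`: a `C^1` curve which is a critical
point of the energy with respect to smooth variations with fixed endpoints. For small `s` the
curve `γ + s • h` stays in the open set `Diff_0^2([0,1])`. -/
structure IsGeodesic (γ : ℝ → H02) : Prop where
  mem : ∀ t ∈ Icc (0 : ℝ) 1, γ t ∈ Diff02
  contDiff : ContDiffOn ℝ 1 γ (Icc 0 1)
  critical : ∀ h : ℝ → H02, ContDiff ℝ ∞ h → h 0 = 0 → h 1 = 0 →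
    HasDerivAt (fun s : ℝ => energy (fun t => γ t + s • h t)) 0 0

end

end SobolevDiff

/-!
Let `u = φ_t ∘ φ⁻¹` be the right-invariant velocity of a geodesic `φ` with `φ(0) = Id`. The
constraints `u(1) = u'(1) = 0` enter the Euler–Lagrange equation through two Lagrange multipliers,
and the equation says that `u_xx ∘ φ` changes in time only by a function that is continuous in
space: `u_xx ∘ φ = v + τ`, where `v` is the second derivative of the initial velocity and
`∂ₓ τ = ∫ (½ φ' (v + τ)² + ν φ') dt`.

On the other hand `∂ₜ (φ'' / φ') = φ' · (u_xx ∘ φ)`, so that `φ'' / φ' = ∫ φ' (v + τ) dt`. At the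
final time the left-hand side is a known function `p`, and `v = (p - ∫ φ' τ) / ∫ φ'`. Eliminating
`v`, the pair `(φ', τ)` solves an ordinary differential equation in the space variable with values
in the continuous functions of time. If `p` is of class `C^m`, the pair is of class `C^(m+1)`, and
the formula for `v` shows that `v` lies in `H^(m+1)` if `p` does.
-/

open Topology

namespace SobolevDiff

noncomputable section

section Spaces

/-- The Hilbert space `L^2(0,1)`. -/
abbrev L2 : Type := Lp ℝ 2 μI

/-- The Banach algebra of continuous functions on `[0,1]`. -/
abbrev CI : Type := C(Icc (0 : ℝ) 1, ℝ)

/-- The extension of a continuous function on `[0,1]` to `ℝ` which is constant outside `[0,1]`. -/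
def ext (c : CI) : ℝ → ℝ := IccExtend zero_le_one c

lemma continuous_ext (c : CI) : Continuous (ext c) := c.continuous.Icc_extend'

lemma ext_of_mem (c : CI) {x : ℝ} (hx : x ∈ Icc (0 : ℝ) 1) : ext c x = c ⟨x, hx⟩ :=
  IccExtend_of_mem _ _ hx

lemma ext_apply_one (c : CI) : ext c 1 = c 1 := ext_of_mem c (right_mem_Icc.2 zero_le_one)

lemma abs_ext_le (c : CI) (x : ℝ) : |ext c x| ≤ ‖c‖ := c.norm_coe_le_norm _

lemma exists_ext_eqOn {f : ℝ → ℝ} (hf : ContinuousOn f (Icc 0 1)) :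
    ∃ c : CI, EqOn (ext c) f (Icc 0 1) :=
  ⟨⟨_, hf.domRestrict⟩, fun _ hx => ext_of_mem _ hx⟩

lemma intervalIntegrable_zero_one {f : ℝ → ℝ} (h : Integrable f μI) :
    IntervalIntegrable f volume 0 1 := by
  rw [intervalIntegrable_iff_integrableOn_Ioo_of_le zero_le_one]
  exact h

lemma intervalIntegrable_zero_of_mem {f : ℝ → ℝ} (h : Integrable f μI) {x : ℝ}
    (hx : x ∈ Icc (0 : ℝ) 1) : IntervalIntegrable f volume 0 x :=
  (intervalIntegrable_zero_one h).mono_set (by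
    rw [uIcc_of_le zero_le_one, uIcc_of_le hx.1]; exact Icc_subset_Icc_right hx.2)

lemma intervalIntegral_congr_ae_μI {f g : ℝ → ℝ} (h : f =ᵐ[μI] g) {y : ℝ}
    (hy : y ∈ Icc (0 : ℝ) 1) : ∫ x in (0 : ℝ)..y, f x = ∫ x in (0 : ℝ)..y, g x := by
  rw [intervalIntegral.integral_of_le hy.1, intervalIntegral.integral_of_le hy.1,
    integral_Ioc_eq_integral_Ioo, integral_Ioc_eq_integral_Ioo]
  exact integral_congr_ae (ae_restrict_of_ae_restrict_of_subset (Ioo_subset_Ioo_right hy.2) h)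

lemma L2.integrable_mul (u v : L2) : Integrable (fun x => u x * v x) μI :=
  (Lp.memLp u).integrable_mul (Lp.memLp v)

lemma L2.integrable (u : L2) : Integrable u μI :=
  (Lp.memLp u).integrable (by norm_num)

lemma memLp_of_continuousOn {h : ℝ → ℝ} (hcont : ContinuousOn h (Icc 0 1)) : MemLp h 2 μI := by
  obtain ⟨C, hC⟩ := isCompact_Icc.exists_bound_of_continuousOn hcont
  refine MemLp.of_bound ((hcont.mono Ioo_subset_Icc_self).aestronglyMeasurable
    measurableSet_Ioo) C ?_
  exact (ae_restrict_iff' measurableSet_Ioo).2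
    (Filter.Eventually.of_forall fun x hx => hC x (Ioo_subset_Icc_self hx))

lemma memLp_ext (c : CI) : MemLp (ext c) 2 μI :=
  memLp_of_continuousOn (continuous_ext c).continuousOn

end Spaces

section ContinuousAction

lemma memLp_ext_mul (c : CI) (u : L2) : MemLp (fun x => ext c x * u x) 2 μI := by
  refine (Lp.memLp u).of_le_mul (c := ‖c‖)
    ((continuous_ext c).aestronglyMeasurable.mul (Lp.aestronglyMeasurable u)) ?_
  refine Filter.Eventually.of_forall fun x => ?_
  rw [norm_mul]
  exact mul_le_mul_of_nonneg_right (abs_ext_le c x) (norm_nonneg _)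

instance : SMul CI L2 := ⟨fun c u => (memLp_ext_mul c u).toLp _⟩

lemma coeFn_smul (c : CI) (u : L2) : (c • u : L2) =ᵐ[μI] fun x => ext c x * u x :=
  (memLp_ext_mul c u).coeFn_toLp

instance : Module CI L2 where
  one_smul u := by
    apply Lp.ext
    filter_upwards [coeFn_smul 1 u] with x hx
    rw [hx]
    exact one_mul _
  mul_smul c d u := by
    apply Lp.ext
    filter_upwards [coeFn_smul (c * d) u, coeFn_smul c (d • u), coeFn_smul d u] with x h h' h''
    rw [h, h', h'']
    exact mul_assoc _ _ _
  smul_zero c := by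
    apply Lp.ext
    filter_upwards [coeFn_smul c 0, Lp.coeFn_zero ℝ 2 μI] with x h h'
    rw [h, h']
    exact mul_zero _
  smul_add c u v := by
    apply Lp.ext
    filter_upwards [coeFn_smul c (u + v), coeFn_smul c u, coeFn_smul c v,
      Lp.coeFn_add u v, Lp.coeFn_add (c • u) (c • v)] with x h1 h2 h3 h4 h5
    rw [h1, h5, Pi.add_apply, h2, h3, h4, Pi.add_apply, mul_add]
  add_smul c d u := by
    apply Lp.ext
    filter_upwards [coeFn_smul (c + d) u, coeFn_smul c u, coeFn_smul d u,
      Lp.coeFn_add (c • u) (d • u)] with x h1 h2 h3 h4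
    rw [h1, h4, Pi.add_apply, h2, h3, ← add_mul]
    rfl
  zero_smul u := by
    apply Lp.ext
    filter_upwards [coeFn_smul 0 u, Lp.coeFn_zero ℝ 2 μI] with x h h'
    rw [h, h']
    exact zero_mul _

instance : IsBoundedSMul CI L2 := IsBoundedSMul.of_norm_smul_le fun c u => by
  apply Lp.norm_le_mul_norm_of_ae_le_mul
  filter_upwards [coeFn_smul c u] with x hx
  rw [hx, norm_mul]
  exact mul_le_mul_of_nonneg_right (abs_ext_le c x) (norm_nonneg _)

instance : IsScalarTower ℝ CI L2 where
  smul_assoc r c u := by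
    apply Lp.ext
    filter_upwards [coeFn_smul (r • c) u, coeFn_smul c u, Lp.coeFn_smul r (c • u)] with x h h' h''
    rw [h, h'', Pi.smul_apply, h', smul_eq_mul, ← mul_assoc]
    rfl

/-- The inclusion of continuous functions into `L^2(0,1)`. -/
def toL2 : CI →L[ℝ] L2 :=
  (ContinuousLinearMap.lsmul ℝ CI).flip ((memLp_const (1 : ℝ)).toLp _)

lemma coeFn_toL2 (c : CI) : toL2 c =ᵐ[μI] ext c := by
  filter_upwards [coeFn_smul c ((memLp_const (1 : ℝ)).toLp _),
    (memLp_const (p := 2) (μ := μI) (1 : ℝ)).coeFn_toLp] with x h h'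
  exact (h.trans (by rw [h', mul_one]))

lemma toL2_mul (c d : CI) : toL2 (c * d) = c • toL2 d := mul_smul c d _

lemma smul_toL2_one (c : CI) : c • toL2 1 = toL2 c := by rw [← toL2_mul, mul_one]

lemma denseRange_toL2 : DenseRange toL2 := by
  refine (BoundedContinuousFunction.toLp_denseRange ℝ (p := 2) μI ℝ (by simp)).mono ?_
  rintro _ ⟨g, rfl⟩
  refine ⟨g.toContinuousMap.restrict (Icc 0 1), Lp.ext ?_⟩
  filter_upwards [coeFn_toL2 (g.toContinuousMap.restrict (Icc 0 1)),
    BoundedContinuousFunction.coeFn_toLp (p := 2) (μ := μI) ℝ g,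
    ae_restrict_mem measurableSet_Ioo] with x h h' hx
  rw [h, h', ext_of_mem _ (Ioo_subset_Icc_self hx)]
  rfl

lemma inner_eq_intervalIntegral (u v : L2) : inner ℝ u v = ∫ x in (0 : ℝ)..1, u x * v x := by
  rw [L2.inner_def, integral_μI]
  simp [mul_comm]

lemma inner_smul_comm (c : CI) (u v : L2) : inner ℝ (c • u) v = inner ℝ u (c • v) := by
  rw [L2.inner_def, L2.inner_def]
  apply integral_congr_ae
  filter_upwards [coeFn_smul c u, coeFn_smul c v] with x h h'
  rw [h, h']
  simp [mul_left_comm, mul_comm, mul_assoc]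

end ContinuousAction

section Primitives

/-- The primitive vanishing at `0` of the product of two functions in `L^2(0,1)`; its bundled
bilinear version is `primitiveMul`. -/
def primitiveMulFun (u v : L2) : CI where
  toFun y := ∫ x in (0 : ℝ)..y, u x * v x
  continuous_toFun := by
    have h := intervalIntegral.continuousOn_primitive_interval (μ := volume)
      (f := fun x => u x * v x) (a := 0) (b := 1) (by
        have := (intervalIntegrable_iff_integrableOn_Icc_of_le zero_le_one).1
          (intervalIntegrable_zero_one (u.integrable_mul v))
        rwa [uIcc_of_le zero_le_one])
    rw [uIcc_of_le zero_le_one] at h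
    exact continuousOn_iff_continuous_domRestrict.1 h

lemma primitiveMulFun_apply (u v : L2) (y : Icc (0 : ℝ) 1) :
    primitiveMulFun u v y = ∫ x in (0 : ℝ)..y, u x * v x := rfl

lemma norm_primitiveMulFun_le (u v : L2) : ‖primitiveMulFun u v‖ ≤ 1 * ‖u‖ * ‖v‖ := by
  rw [one_mul, ContinuousMap.norm_le _ (by positivity)]
  intro y
  rw [primitiveMulFun_apply, intervalIntegral.integral_of_le y.2.1]
  have hi : Integrable (fun x => |u x| * |v x|) μI := by
    simpa only [abs_mul] using (u.integrable_mul v).abs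
  calc ‖∫ x in Ioc (0 : ℝ) y, u x * v x‖ ≤ ∫ x in Ioc (0 : ℝ) y, ‖u x * v x‖ :=
        norm_integral_le_integral_norm _
    _ = ∫ x in Ioo (0 : ℝ) y, |u x| * |v x| := by
        rw [integral_Ioc_eq_integral_Ioo]; simp only [Real.norm_eq_abs, abs_mul]
    _ ≤ ∫ x in Ioo (0 : ℝ) 1, |u x| * |v x| :=
        setIntegral_mono_set hi (Filter.Eventually.of_forall fun x => by positivity)
          (Ioo_subset_Ioo_right y.2.2).eventuallyLE
    _ = inner ℝ |u| |v| := by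
        rw [L2.inner_def]
        apply integral_congr_ae
        filter_upwards [Lp.coeFn_abs u, Lp.coeFn_abs v] with x h h'
        simp [h, h', mul_comm]
    _ ≤ ‖|u|‖ * ‖|v|‖ := real_inner_le_norm _ _
    _ = ‖u‖ * ‖v‖ := by rw [norm_abs_eq_norm, norm_abs_eq_norm]

lemma primitiveMulFun_comm (u v : L2) : primitiveMulFun u v = primitiveMulFun v u := by
  ext y
  simp only [primitiveMulFun_apply, mul_comm]

lemma primitiveMulFun_add (u v w : L2) :
    primitiveMulFun u (v + w) = primitiveMulFun u v + primitiveMulFun u w := by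
  ext y
  simp only [primitiveMulFun_apply, ContinuousMap.add_apply]
  rw [← intervalIntegral.integral_add (intervalIntegrable_zero_of_mem (u.integrable_mul v) y.2)
    (intervalIntegrable_zero_of_mem (u.integrable_mul w) y.2)]
  apply intervalIntegral_congr_ae_μI _ y.2
  filter_upwards [Lp.coeFn_add v w] with x h
  rw [h, Pi.add_apply, mul_add]

lemma primitiveMulFun_smul (c : ℝ) (u v : L2) :
    primitiveMulFun u (c • v) = c • primitiveMulFun u v := by
  ext y
  simp only [primitiveMulFun_apply, ContinuousMap.smul_apply, smul_eq_mul]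
  rw [← intervalIntegral.integral_const_mul]
  apply intervalIntegral_congr_ae_μI _ y.2
  filter_upwards [Lp.coeFn_smul c v] with x h
  rw [h, Pi.smul_apply, smul_eq_mul]
  ring

/-- The continuous bilinear map which sends `(u, v)` to the primitive of `u * v`. -/
def primitiveMul : L2 →L[ℝ] L2 →L[ℝ] CI :=
  LinearMap.mkContinuous₂ (LinearMap.mk₂ ℝ primitiveMulFun
    (fun u v w => by
      rw [primitiveMulFun_comm, primitiveMulFun_add, primitiveMulFun_comm w,
        primitiveMulFun_comm w])
    (fun c u v => by rw [primitiveMulFun_comm, primitiveMulFun_smul, primitiveMulFun_comm])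
    primitiveMulFun_add primitiveMulFun_smul) 1 norm_primitiveMulFun_le

lemma primitiveMul_apply (u v : L2) (y : Icc (0 : ℝ) 1) :
    primitiveMul u v y = ∫ x in (0 : ℝ)..y, u x * v x := rfl

lemma primitiveMul_apply_one (u v : L2) : primitiveMul u v 1 = inner ℝ u v :=
  (inner_eq_intervalIntegral u v).symm

lemma primitiveMul_smul_comm (c : CI) (u v : L2) :
    primitiveMul (c • u) v = primitiveMul u (c • v) := by
  ext y
  rw [primitiveMul_apply, primitiveMul_apply]
  apply intervalIntegral_congr_ae_μI _ y.2
  filter_upwards [coeFn_smul c u, coeFn_smul c v] with x h h'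
  rw [h, h']
  ring

/-- The primitive vanishing at `0` of a function in `L^2(0,1)`. -/
def primitive : L2 →L[ℝ] CI := primitiveMul (toL2 1)

lemma primitive_apply (u : L2) (y : Icc (0 : ℝ) 1) : primitive u y = ∫ x in (0 : ℝ)..y, u x := by
  rw [primitive, primitiveMul_apply]
  apply intervalIntegral_congr_ae_μI _ y.2
  filter_upwards [coeFn_toL2 1] with x h
  rw [h]
  exact one_mul _

lemma ext_primitive (u : L2) {x : ℝ} (hx : x ∈ Icc (0 : ℝ) 1) :
    ext (primitive u) x = ∫ y in (0 : ℝ)..x, u y := by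
  rw [ext_of_mem _ hx, primitive_apply]

lemma ext_primitive_zero (u : L2) : ext (primitive u) 0 = 0 := by
  rw [ext_primitive _ (left_mem_Icc.2 zero_le_one), intervalIntegral.integral_same]

lemma primitive_apply_one (u : L2) : primitive u 1 = inner ℝ (toL2 1) u :=
  primitiveMul_apply_one _ _

lemma primitive_smul (c : CI) (u : L2) : primitive (c • u) = primitiveMul (toL2 c) u := by
  rw [primitive, ← primitiveMul_smul_comm, smul_toL2_one]

lemma inner_toL2 (c : CI) (u : L2) : inner ℝ (toL2 c) u = primitive (c • u) 1 := by
  rw [primitive_apply_one, ← inner_smul_comm, smul_toL2_one]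

lemma primitive_toL2_apply (c : CI) (y : Icc (0 : ℝ) 1) :
    primitive (toL2 c) y = ∫ x in (0 : ℝ)..y, ext c x := by
  rw [primitive_apply]
  exact intervalIntegral_congr_ae_μI (coeFn_toL2 c) y.2

lemma hasDerivAt_integral_ext (c : CI) (x : ℝ) :
    HasDerivAt (fun x => ∫ y in (0 : ℝ)..x, ext c y) (ext c x) x :=
  ((continuous_ext c).integral_hasStrictDerivAt 0 x).hasDerivAt

lemma hasDerivWithinAt_ext_primitive_toL2 (c : CI) {x : ℝ} (hx : x ∈ Icc (0 : ℝ) 1) :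
    HasDerivWithinAt (ext (primitive (toL2 c))) (ext c x) (Icc 0 1) x :=
  (hasDerivAt_integral_ext c x).hasDerivWithinAt.congr_of_mem
    (fun y hy => by rw [ext_of_mem _ hy, primitive_toL2_apply]) hx

lemma primitive_mul_primitive_apply {f g : ℝ → ℝ} (hf : Integrable f μI) (hg : Integrable g μI)
    {x : ℝ} (hx : x ∈ Icc (0 : ℝ) 1) :
    (∫ y in (0 : ℝ)..x, f y) * (∫ y in (0 : ℝ)..x, g y) =
      ∫ y in (0 : ℝ)..x, (f y * (∫ s in (0 : ℝ)..y, g s) + (∫ s in (0 : ℝ)..y, f s) * g y) := by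
  have hf' := intervalIntegrable_zero_of_mem hf hx
  have hg' := intervalIntegrable_zero_of_mem hg hx
  have leibniz := AbsolutelyContinuousOnInterval.integral_deriv_mul_eq_sub
    (hf'.absolutelyContinuousOnInterval_intervalIntegral (c := 0) (by simp))
    (hg'.absolutelyContinuousOnInterval_intervalIntegral (c := 0) (by simp))
  simp only [intervalIntegral.integral_same, mul_zero, sub_zero] at leibniz
  rw [← leibniz]
  apply intervalIntegral.integral_congr_ae
  filter_upwards [hf'.ae_hasDerivAt_integral, hg'.ae_hasDerivAt_integral] with y h h' hy
  have hy' := uIoc_subset_uIcc hy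
  rw [(h hy' 0 (by simp)).deriv, (h' hy' 0 (by simp)).deriv]

lemma primitiveMul_mul_primitive (u v k : L2) :
    primitiveMul u v * primitive k =
      primitiveMul u (primitive k • v) + primitive (primitiveMul u v • k) := by
  ext x
  have hi := u.integrable_mul v
  rw [ContinuousMap.mul_apply, primitiveMul_apply, primitive_apply,
    primitive_mul_primitive_apply hi k.integrable x.2, ContinuousMap.add_apply,
    primitiveMul_apply, primitive_apply,
    ← intervalIntegral.integral_add (intervalIntegrable_zero_of_mem (u.integrable_mul _) x.2)
    (intervalIntegrable_zero_of_mem (L2.integrable _) x.2)]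
  apply intervalIntegral_congr_ae_μI _ x.2
  filter_upwards [coeFn_smul (primitive k) v, coeFn_smul (primitiveMul u v) k,
    ae_restrict_mem measurableSet_Ioo] with y h h' hy
  rw [h, h', ext_primitive _ (Ioo_subset_Icc_self hy), ext_of_mem _ (Ioo_subset_Icc_self hy),
    primitiveMul_apply]
  ring

lemma primitive_mul_primitive (u v : L2) :
    primitive u * primitive v = primitive (primitive v • u) + primitive (primitive u • v) :=
  primitiveMul_mul_primitive (toL2 1) u v

end Primitives

section WeakDerivatives

lemma IsTest.apply_zero {ψ : ℝ → ℝ} (h : IsTest ψ) : ψ 0 = 0 :=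
  image_eq_zero_of_notMem_tsupport fun h0 => lt_irrefl _ (h.supp h0).1

lemma IsTest.apply_one {ψ : ℝ → ℝ} (h : IsTest ψ) : ψ 1 = 0 :=
  image_eq_zero_of_notMem_tsupport fun h1 => lt_irrefl _ (h.supp h1).2

lemma IsTest.integrable {ψ : ℝ → ℝ} (h : IsTest ψ) : Integrable ψ μI :=
  h.memLp.integrable (by norm_num)

lemma IsTest.hasDerivAt {ψ : ℝ → ℝ} (h : IsTest ψ) (x : ℝ) : HasDerivAt ψ (_root_.deriv ψ x) x :=
  (h.smooth.differentiable (by simp) x).hasDerivAt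

lemma IsTest.integral_deriv {ψ : ℝ → ℝ} (h : IsTest ψ) (x : ℝ) :
    ∫ y in (0 : ℝ)..x, _root_.deriv ψ y = ψ x := by
  rw [intervalIntegral.integral_eq_sub_of_hasDerivAt (fun y _ => h.hasDerivAt y)
    (h.deriv.smooth.continuous.intervalIntegrable _ _), h.apply_zero, sub_zero]

lemma IsTest.exists_deriv_eq_sub {χ ρ : ℝ → ℝ} (hχ : IsTest χ) (hρ : IsTest ρ)
    (hρ1 : ∫ x, ρ x ∂μI = 1) :
    ∃ ψ, IsTest ψ ∧ _root_.deriv ψ = fun x => χ x - (∫ x, χ x ∂μI) * ρ x := by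
  refine exists_primitive ⟨hχ.smooth.sub (contDiff_const.mul hρ.smooth),
    hχ.compact.sub hρ.compact.mul_left, ?_⟩ ?_
  · exact (tsupport_sub _ _).trans
      (union_subset hχ.supp (tsupport_mul_subset_right.trans hρ.supp))
  · rw [← integral_μI, integral_sub hχ.integrable (hρ.integrable.const_mul _),
      integral_const_mul, hρ1, mul_one, sub_self]

lemma ae_eq_const_of_integral_mul_deriv_eq_zero {h : ℝ → ℝ} (hmem : MemLp h 2 μI)
    (hh : ∀ ψ, IsTest ψ → ∫ x, h x * deriv ψ x ∂μI = 0) : ∃ c : ℝ, h =ᵐ[μI] fun _ => c := by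
  obtain ⟨ρ, hρ, hρ1⟩ := exists_bump
  rw [← integral_μI] at hρ1
  set c := ∫ x, h x * ρ x ∂μI
  have hsub : (fun x => h x - c) =ᵐ[μI] 0 := by
    refine ae_zero_of_test (hmem.sub (memLp_const c)) fun χ hχ => ?_
    set m := ∫ x, χ x ∂μI
    obtain ⟨ψ, hψ, hψ'⟩ := hχ.exists_deriv_eq_sub hρ hρ1
    have hκ : ∫ x, h x * χ x - m * (h x * ρ x) ∂μI = 0 := by
      rw [← hh ψ hψ, hψ']
      exact integral_congr_ae (Filter.Eventually.of_forall fun x => by ring)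
    rw [integral_sub (integrable_mul_test hmem hχ) ((integrable_mul_test hmem hρ).const_mul m),
      integral_const_mul] at hκ
    simp only [sub_mul]
    rw [integral_sub (integrable_mul_test hmem hχ) (hχ.integrable.const_mul c),
      integral_const_mul, mul_comm c]
    exact hκ
  exact ⟨c, hsub.mono fun x hx => sub_eq_zero.1 hx⟩

lemma IsWeakDeriv.congr_left {k : ℕ} {f f' g : ℝ → ℝ} (h : IsWeakDeriv k f g) (hf : f =ᵐ[μI] f') :
    IsWeakDeriv k f' g := by
  intro ψ hψ
  rw [← h ψ hψ]
  apply integral_congr_ae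
  filter_upwards [hf] with x hx
  rw [hx]

lemma IsWeakDeriv.succ {k : ℕ} {f g h : ℝ → ℝ} (h1 : IsWeakDeriv 1 f g) (h2 : IsWeakDeriv k g h) :
    IsWeakDeriv (k + 1) f h := by
  intro ψ hψ
  have hfg := h1 _ (hψ.iteratedDeriv k)
  rw [iteratedDeriv_one] at hfg
  rw [iteratedDeriv_succ, hfg, h2 ψ hψ]
  ring

lemma IsWeakDeriv.of_succ {k : ℕ} {f g h : ℝ → ℝ} (h1 : IsWeakDeriv 1 f g)
    (h2 : IsWeakDeriv (k + 1) f h) : IsWeakDeriv k g h := by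
  intro ψ hψ
  have hfg := h1 _ (hψ.iteratedDeriv k)
  have hfh := h2 ψ hψ
  rw [iteratedDeriv_one] at hfg
  rw [iteratedDeriv_succ, hfg, pow_one, pow_succ] at hfh
  linarith

lemma isWeakDeriv_zero (f : ℝ → ℝ) : IsWeakDeriv 0 f f := by
  intro ψ _
  simp

lemma IsWeakDeriv.sub {k : ℕ} {f₁ f₂ g₁ g₂ : ℝ → ℝ} (hf₁ : MemLp f₁ 2 μI) (hf₂ : MemLp f₂ 2 μI)
    (hg₁ : MemLp g₁ 2 μI) (hg₂ : MemLp g₂ 2 μI) (h₁ : IsWeakDeriv k f₁ g₁)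
    (h₂ : IsWeakDeriv k f₂ g₂) : IsWeakDeriv k (f₁ - f₂) (g₁ - g₂) := by
  simpa [sub_eq_add_neg] using IsWeakDeriv.add hf₁ (hf₂.const_smul (-1 : ℝ)) hg₁
    (hg₂.const_smul (-1 : ℝ)) h₁ (h₂.smul (-1))

lemma isWeakDeriv_const (c : ℝ) : IsWeakDeriv 1 (fun _ => c) 0 := by
  intro ψ hψ
  rw [iteratedDeriv_one, integral_const_mul, integral_μI, hψ.integral_deriv, hψ.apply_one]
  simp

lemma isWeakDeriv_primitive (u : L2) : IsWeakDeriv 1 (ext (primitive u)) u := by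
  intro ψ hψ
  have hψ' : Integrable (deriv ψ) μI := hψ.deriv.integrable
  have parts := primitive_mul_primitive_apply u.integrable hψ' (right_mem_Icc.2 zero_le_one)
  simp only [hψ.integral_deriv, hψ.apply_one, mul_zero] at parts
  rw [← integral_μI, integral_congr_ae (g := fun y => u y * ψ y +
      ext (primitive u) y * deriv ψ y) ((ae_restrict_mem measurableSet_Ioo).mono fun y hy => by
        simp only [ext_primitive _ (Ioo_subset_Icc_self hy)]),
    integral_add (integrable_mul_test (Lp.memLp u) hψ)
      (integrable_mul_test (memLp_ext _) hψ.deriv)] at parts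
  rw [iteratedDeriv_one, pow_one]
  linarith

lemma isWeakDeriv_one_iff {f : ℝ → ℝ} {g : L2} (hf : MemLp f 2 μI) :
    IsWeakDeriv 1 f g ↔ ∃ c : ℝ, f =ᵐ[μI] fun x => c + ext (primitive g) x := by
  constructor
  · intro h
    have hs := IsWeakDeriv.sub hf (memLp_ext _) (Lp.memLp g) (Lp.memLp g) h
      (isWeakDeriv_primitive g)
    obtain ⟨c, hc⟩ := ae_eq_const_of_integral_mul_deriv_eq_zero
      (hf.sub (memLp_ext (primitive g))) fun ψ hψ => by
        simpa [iteratedDeriv_one] using hs ψ hψ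
    exact ⟨c, hc.mono fun x hx => sub_eq_iff_eq_add.1 hx⟩
  · rintro ⟨c, hc⟩
    refine IsWeakDeriv.congr_left ?_ hc.symm
    have hadd := IsWeakDeriv.add (memLp_const c) (memLp_ext _) MemLp.zero (Lp.memLp g)
      (isWeakDeriv_const c) (isWeakDeriv_primitive g)
    rwa [zero_add] at hadd

lemma isWeakDeriv_of_hasDerivWithinAt {f f' : ℝ → ℝ}
    (hf : ∀ x ∈ Icc (0 : ℝ) 1, HasDerivWithinAt f (f' x) (Icc 0 1) x)
    (hf' : ContinuousOn f' (Icc 0 1)) : IsWeakDeriv 1 f f' := by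
  intro ψ hψ
  have parts := intervalIntegral.integral_mul_deriv_eq_deriv_mul_of_hasDerivAt
    (a := 0) (b := 1) (u := f) (u' := f') (v := ψ) (v' := deriv ψ)
    (by rw [uIcc_of_le zero_le_one]; exact fun x hx => (hf x hx).continuousWithinAt)
    (hψ.smooth.continuous.continuousOn)
    (by
      rw [min_eq_left zero_le_one, max_eq_right zero_le_one]
      exact fun x hx => (hf x (Ioo_subset_Icc_self hx)).hasDerivAt (Icc_mem_nhds hx.1 hx.2))
    (fun x _ => hψ.hasDerivAt x)
    (ContinuousOn.intervalIntegrable (by rwa [uIcc_of_le zero_le_one]))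
    (hψ.deriv.smooth.continuous.intervalIntegrable _ _)
  rw [hψ.apply_zero, hψ.apply_one] at parts
  rw [iteratedDeriv_one, integral_μI, integral_μI, parts]
  ring

lemma IsWeakDeriv.mul {f₁ f₂ : ℝ → ℝ} {g₁ g₂ : L2} (hf₁ : MemLp f₁ 2 μI) (hf₂ : MemLp f₂ 2 μI)
    (h₁ : IsWeakDeriv 1 f₁ g₁) (h₂ : IsWeakDeriv 1 f₂ g₂) (hf : MemLp (f₁ * f₂) 2 μI) :
    IsWeakDeriv 1 (f₁ * f₂) (g₁ * f₂ + f₁ * g₂) := by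
  obtain ⟨c₁, hc₁⟩ := (isWeakDeriv_one_iff hf₁).1 h₁
  obtain ⟨c₂, hc₂⟩ := (isWeakDeriv_one_iff hf₂).1 h₂
  set V₁ := primitive g₁
  set V₂ := primitive g₂
  set G : L2 := (c₂ • g₁ + V₂ • g₁) + (c₁ • g₂ + V₁ • g₂)
  have hV : primitive G = c₂ • V₁ + c₁ • V₂ + V₁ * V₂ := by
    rw [primitive_mul_primitive]
    simp only [G, map_add, map_smul]
    abel
  have hG : IsWeakDeriv 1 (f₁ * f₂) G := by
    refine (isWeakDeriv_one_iff hf).2 ⟨c₁ * c₂, ?_⟩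
    filter_upwards [hc₁, hc₂] with x hx₁ hx₂
    rw [Pi.mul_apply, hx₁, hx₂, hV]
    change (c₁ + ext V₁ x) * (c₂ + ext V₂ x) =
      c₁ * c₂ + (c₂ * ext V₁ x + c₁ * ext V₂ x + ext V₁ x * ext V₂ x)
    ring
  refine hG.congr ?_
  filter_upwards [hc₁, hc₂, Lp.coeFn_add (c₂ • g₁ + V₂ • g₁) (c₁ • g₂ + V₁ • g₂),
    Lp.coeFn_add (c₂ • g₁) (V₂ • g₁), Lp.coeFn_add (c₁ • g₂) (V₁ • g₂), Lp.coeFn_smul c₂ g₁,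
    Lp.coeFn_smul c₁ g₂, coeFn_smul V₂ g₁, coeFn_smul V₁ g₂] with x h1 h2 h3 h4 h5 h6 h7 h8 h9
  simp only [G, h3, Pi.add_apply, h4, h5, h6, h7, h8, h9, Pi.smul_apply, smul_eq_mul,
    Pi.mul_apply, h1, h2]
  ring

lemma eqOn_Icc_of_ae_eq {f g : ℝ → ℝ} (hf : ContinuousOn f (Icc 0 1))
    (hg : ContinuousOn g (Icc 0 1)) (h : f =ᵐ[μI] g) : EqOn f g (Icc 0 1) := by
  have hIoo : EqOn f g (Ioo 0 1) :=
    Measure.eqOn_open_of_ae_eq h isOpen_Ioo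
      (hf.mono Ioo_subset_Icc_self) (hg.mono Ioo_subset_Icc_self)
  exact hIoo.of_subset_closure hf hg Ioo_subset_Icc_self (by rw [closure_Ioo zero_ne_one])

lemma ae_eq_of_eqOn_Icc {f g : ℝ → ℝ} (h : EqOn f g (Icc 0 1)) : f =ᵐ[μI] g :=
  (ae_restrict_mem measurableSet_Ioo).mono fun _ hx => h (Ioo_subset_Icc_self hx)

lemma eq_toL2_of_ae_eq {u : L2} {c : CI} (h : u =ᵐ[μI] ext c) : u = toL2 c :=
  Lp.ext (h.trans (coeFn_toL2 c).symm)

end WeakDerivatives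

section Sobolev

lemma MemH.of_le {m n : ℕ} {f : ℝ → ℝ} (hf : MemH n f) (h : m ≤ n) : MemH m f :=
  ⟨hf.1, fun k hk => hf.2 k (hk.trans h)⟩

lemma MemH.congr {m : ℕ} {f g : ℝ → ℝ} (hf : MemH m f) (h : f =ᵐ[μI] g) : MemH m g :=
  ⟨hf.1.ae_eq h, fun k hk => (hf.2 k hk).imp fun _ hu => ⟨hu.1, hu.2.congr_left h⟩⟩

lemma memH_zero_iff {f : ℝ → ℝ} : MemH 0 f ↔ MemLp f 2 μI :=
  ⟨fun h => h.1, fun h => ⟨h, fun k hk => ⟨f, h, by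
    rw [Nat.le_zero.1 hk]; exact isWeakDeriv_zero f⟩⟩⟩

lemma memH_succ_iff {m : ℕ} {f : ℝ → ℝ} :
    MemH (m + 1) f ↔ MemLp f 2 μI ∧ ∃ g : L2, MemH m g ∧ IsWeakDeriv 1 f g := by
  constructor
  · rintro ⟨hf, h⟩
    obtain ⟨g, hg, hfg⟩ := h 1 (by omega)
    have hfg' : IsWeakDeriv 1 f (hg.toLp g) := hfg.congr hg.coeFn_toLp.symm
    refine ⟨hf, hg.toLp g, ⟨Lp.memLp _, fun k hk => ?_⟩, hfg'⟩
    obtain ⟨u, hu, hfu⟩ := h (k + 1) (by omega)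
    exact ⟨u, hu, hfg'.of_succ hfu⟩
  · rintro ⟨hf, g, hg, hfg⟩
    refine ⟨hf, fun k hk => ?_⟩
    cases k with
    | zero => exact ⟨f, hf, isWeakDeriv_zero f⟩
    | succ k =>
      obtain ⟨u, hu, hgu⟩ := hg.2 k (by omega)
      exact ⟨u, hu, hfg.succ hgu⟩

lemma IsWeakDeriv.memH_succ {m : ℕ} {f g : ℝ → ℝ} (h : IsWeakDeriv 1 f g) (hf : MemLp f 2 μI)
    (hg : MemH m g) : MemH (m + 1) f :=
  memH_succ_iff.2 ⟨hf, hg.1.toLp g, hg.congr hg.1.coeFn_toLp.symm,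
    h.congr hg.1.coeFn_toLp.symm⟩

lemma exists_isWeakDeriv_of_contDiffOn {m : ℕ} {f : ℝ → ℝ}
    (hf : ContDiffOn ℝ (m + 1 : ℕ) f (Icc 0 1)) :
    ∃ g, ContDiffOn ℝ m g (Icc 0 1) ∧ IsWeakDeriv 1 f g := by
  push_cast at hf
  obtain ⟨hd, -, hf'⟩ := (contDiffOn_succ_iff_derivWithin (uniqueDiffOn_Icc zero_lt_one)).1 hf
  exact ⟨_, hf', isWeakDeriv_of_hasDerivWithinAt (fun x hx => (hd x hx).hasDerivWithinAt)
    hf'.continuousOn⟩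

lemma memH_of_contDiffOn {m : ℕ} {f : ℝ → ℝ} (hf : ContDiffOn ℝ m f (Icc 0 1)) : MemH m f := by
  induction m generalizing f with
  | zero => exact memH_zero_iff.2 (memLp_of_continuousOn hf.continuousOn)
  | succ m ih =>
    obtain ⟨g, hg, hfg⟩ := exists_isWeakDeriv_of_contDiffOn hf
    exact hfg.memH_succ (memLp_of_continuousOn hf.continuousOn) (ih hg)

lemma MemH.contDiffOn_mul {m : ℕ} {c f : ℝ → ℝ} (hc : ContDiffOn ℝ m c (Icc 0 1))
    (hf : MemH m f) : MemH m (c * f) := by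
  have memLp_mul : ∀ {c f : ℝ → ℝ}, ContinuousOn c (Icc 0 1) → MemLp f 2 μI →
      MemLp (c * f) 2 μI := fun {c f} hc hf => by
    obtain ⟨d, hd⟩ := exists_ext_eqOn hc
    refine (memLp_ext_mul d (hf.toLp f)).ae_eq ?_
    filter_upwards [hf.coeFn_toLp, ae_eq_of_eqOn_Icc hd] with x h h'
    rw [h, h', Pi.mul_apply]
  induction m generalizing c f with
  | zero => exact memH_zero_iff.2 (memLp_mul hc.continuousOn hf.1)
  | succ m ih =>
    obtain ⟨c', hc', hcc'⟩ := exists_isWeakDeriv_of_contDiffOn hc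
    obtain ⟨-, g, hg, hfg⟩ := memH_succ_iff.1 hf
    have hc'L := memLp_of_continuousOn hc'.continuousOn
    have hcf := memLp_mul hc.continuousOn hf.1
    have hderiv := IsWeakDeriv.mul (memLp_of_continuousOn hc.continuousOn) hf.1
      (hcc'.congr hc'L.coeFn_toLp.symm) hfg hcf
    refine (hderiv.congr ?_).memH_succ hcf
      ((ih hc' (hf.of_le m.le_succ)).add (ih (hc.of_le (by exact_mod_cast m.le_succ)) hg))
    filter_upwards [hc'L.coeFn_toLp] with x hx
    simp only [Pi.add_apply, Pi.mul_apply, hx]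

lemma MemH.exists_contDiffOn {m : ℕ} {f : ℝ → ℝ} (hf : MemH (m + 1) f) :
    ∃ p, ContDiffOn ℝ m p (Icc 0 1) ∧ f =ᵐ[μI] p := by
  induction m generalizing f with
  | zero =>
    obtain ⟨hfL, g, -, hfg⟩ := memH_succ_iff.1 hf
    obtain ⟨c, hc⟩ := (isWeakDeriv_one_iff hfL).1 hfg
    exact ⟨_, contDiffOn_zero.2 (continuousOn_const.add (continuous_ext _).continuousOn), hc⟩
  | succ m ih =>
    obtain ⟨hfL, g, hg, hfg⟩ := memH_succ_iff.1 hf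
    obtain ⟨c, hc⟩ := (isWeakDeriv_one_iff hfL).1 hfg
    obtain ⟨p, hp, hgp⟩ := ih hg
    obtain ⟨d, hd⟩ := exists_ext_eqOn hp.continuousOn
    refine ⟨_, ?_, hc⟩
    rw [eq_toL2_of_ae_eq (hgp.trans (ae_eq_of_eqOn_Icc hd.symm))]
    push_cast
    refine contDiffOn_const.add ((contDiffOn_succ_iff_derivWithin
      (uniqueDiffOn_Icc zero_lt_one)).2 ⟨fun x hx =>
        (hasDerivWithinAt_ext_primitive_toL2 d hx).differentiableWithinAt, by simp, ?_⟩)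
    exact hp.congr fun x hx => ((hasDerivWithinAt_ext_primitive_toL2 d hx).derivWithin
      (uniqueDiffOn_Icc zero_lt_one x hx)).trans (hd hx)

end Sobolev

section SecondDerivative

/-- The second derivative as an isometric embedding of `H_0^2([0,1])` into `L^2(0,1)`. -/
def D : H02 →ₗᵢ[ℝ] L2 := ⟨H02.d2, fun _ => rfl⟩

lemma H02.contDiffOn (f : H02) : ContDiffOn ℝ 1 f (Icc 0 1) := f.prop.2.1

lemma H02.hasDerivWithinAt_derivWithin (f : H02) {x : ℝ} (hx : x ∈ Icc (0 : ℝ) 1) :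
    HasDerivWithinAt f (derivWithin f (Icc 0 1) x) (Icc 0 1) x :=
  (f.contDiffOn.differentiableOn one_ne_zero x hx).hasDerivWithinAt

lemma H02.continuousOn_derivWithin (f : H02) : ContinuousOn (derivWithin f (Icc 0 1)) (Icc 0 1) :=
  f.contDiffOn.continuousOn_derivWithin (uniqueDiffOn_Icc zero_lt_one) le_rfl

lemma H02.isWeakDeriv_derivWithin (f : H02) : IsWeakDeriv 1 f (derivWithin f (Icc 0 1)) :=
  isWeakDeriv_of_hasDerivWithinAt (fun _ hx => f.hasDerivWithinAt_derivWithin hx)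
    f.continuousOn_derivWithin

lemma H02.isWeakDeriv_D (f : H02) : IsWeakDeriv 1 (derivWithin f (Icc 0 1)) (D f) :=
  f.isWeakDeriv_derivWithin.of_succ (weakD2_spec f.prop.1)

lemma H02.derivWithin_eqOn (f : H02) :
    EqOn (derivWithin f (Icc 0 1)) (ext (primitive (D f))) (Icc 0 1) := by
  obtain ⟨c, hc⟩ := (isWeakDeriv_one_iff
    (memLp_of_continuousOn f.continuousOn_derivWithin)).1 f.isWeakDeriv_D
  have heq := eqOn_Icc_of_ae_eq f.continuousOn_derivWithin
    (continuousOn_const.add (continuous_ext _).continuousOn) hc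
  have hc0 : c = 0 := by
    have h0 := heq (left_mem_Icc.2 zero_le_one)
    simpa [f.prop.2.2.2.2.1, ext_primitive_zero] using h0.symm
  intro x hx
  rw [heq hx, hc0, Pi.add_apply, zero_add]

lemma H02.hasDerivWithinAt (f : H02) {x : ℝ} (hx : x ∈ Icc (0 : ℝ) 1) :
    HasDerivWithinAt f (ext (primitive (D f)) x) (Icc 0 1) x :=
  f.derivWithin_eqOn hx ▸ f.hasDerivWithinAt_derivWithin hx

lemma H02.memH_iff_D {m : ℕ} {f : H02} : MemH (m + 2) f ↔ MemH m (D f) := by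
  refine ⟨fun hf => ⟨Lp.memLp _, fun k hk => ?_⟩, fun hD => ?_⟩
  · obtain ⟨g, hg, hfg⟩ := hf.2 (k + 2) (by omega)
    exact ⟨g, hg, f.isWeakDeriv_D.of_succ (f.isWeakDeriv_derivWithin.of_succ hfg)⟩
  · exact f.isWeakDeriv_derivWithin.memH_succ f.prop.1.1
      (f.isWeakDeriv_D.memH_succ (memLp_of_continuousOn f.continuousOn_derivWithin) hD)

lemma exists_D_eq {κ : L2} (h1 : primitive κ 1 = 0) (h2 : primitive (toL2 (primitive κ)) 1 = 0) :
    ∃ f : H02, D f = κ := by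
  set f : ℝ → ℝ := (Icc 0 1).indicator (ext (primitive (toL2 (primitive κ))))
  have hf : EqOn f (ext (primitive (toL2 (primitive κ)))) (Icc 0 1) := eqOn_indicator
  have hder : ∀ x ∈ Icc (0 : ℝ) 1, HasDerivWithinAt f (ext (primitive κ) x) (Icc 0 1) x :=
    fun x hx => (hasDerivWithinAt_ext_primitive_toL2 _ hx).congr_of_mem hf hx
  have hderiv : EqOn (derivWithin f (Icc 0 1)) (ext (primitive κ)) (Icc 0 1) := fun x hx =>
    (hder x hx).derivWithin (uniqueDiffOn_Icc zero_lt_one x hx)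
  have hC1 : ContDiffOn ℝ 1 f (Icc 0 1) := by
    rw [contDiffOn_one_iff_derivWithin (uniqueDiffOn_Icc zero_lt_one)]
    exact ⟨fun x hx => (hder x hx).differentiableWithinAt,
      (continuous_ext (primitive κ)).continuousOn.congr hderiv⟩
  have hw : IsWeakDeriv 1 f (ext (primitive κ)) :=
    isWeakDeriv_of_hasDerivWithinAt hder (continuous_ext _).continuousOn
  have hmem : MemH 2 f := hw.memH_succ (memLp_of_continuousOn hC1.continuousOn)
    ((isWeakDeriv_primitive κ).memH_succ (memLp_ext _) (memH_zero_iff.2 (Lp.memLp κ)))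
  refine ⟨⟨f, hmem, hC1, ?_, ?_, ?_, ?_, fun x hx => indicator_of_notMem hx _⟩,
    weakD2_unique (weakD2_spec hmem) (hw.succ (isWeakDeriv_primitive κ))⟩
  · rw [hf (left_mem_Icc.2 zero_le_one), ext_primitive_zero]
  · rw [hf (right_mem_Icc.2 zero_le_one), ext_apply_one, h2]
  · rw [hderiv (left_mem_Icc.2 zero_le_one), ext_primitive_zero]
  · rw [hderiv (right_mem_Icc.2 zero_le_one), ext_apply_one, h1]

lemma H02.primitive_D_one (f : H02) : primitive (D f) 1 = 0 := by
  rw [← ext_apply_one, ← f.derivWithin_eqOn (right_mem_Icc.2 zero_le_one), f.prop.2.2.2.2.2.1]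

lemma H02.eqOn_ext_primitive (f : H02) :
    EqOn f (ext (primitive (toL2 (primitive (D f))))) (Icc 0 1) := by
  have hderiv : ∀ x ∈ Icc (0 : ℝ) 1, HasDerivWithinAt
      (fun y => f y - ext (primitive (toL2 (primitive (D f)))) y) 0 (Icc 0 1) x := fun x hx =>
    ((f.hasDerivWithinAt hx).sub (hasDerivWithinAt_ext_primitive_toL2 _ hx)).congr_deriv
      (sub_self _)
  intro x hx
  have hconst := constant_of_derivWithin_zero
    (fun y hy => (hderiv y hy).differentiableWithinAt)
    (fun y hy => (hderiv y (Ico_subset_Icc_self hy)).derivWithin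
      (uniqueDiffOn_Icc zero_lt_one y (Ico_subset_Icc_self hy))) x hx
  rw [f.prop.2.2.1, ext_primitive_zero] at hconst
  linarith

lemma H02.primitive_toL2_primitive_D_one (f : H02) :
    primitive (toL2 (primitive (D f))) 1 = 0 := by
  rw [← ext_apply_one, ← f.eqOn_ext_primitive (right_mem_Icc.2 zero_le_one), f.prop.2.2.2.1]

end SecondDerivative

section Calculus

variable {Y : Type*} [NormedAddCommGroup Y] {a b t : ℝ} {f : ℝ → Y}

lemma intervalIntegrable_of_continuousOn_Icc (hf : ContinuousOn f (Icc a b)) (ht : t ∈ Icc a b) :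
    IntervalIntegrable f volume a t :=
  ContinuousOn.intervalIntegrable (by
    rw [uIcc_of_le ht.1]; exact hf.mono (Icc_subset_Icc_right ht.2))

variable [NormedSpace ℝ Y] [CompleteSpace Y]

lemma hasDerivWithinAt_integral (hf : ContinuousOn f (Icc a b)) (ht : t ∈ Icc a b) :
    HasDerivWithinAt (fun t => ∫ s in a..t, f s) (f t) (Icc a b) t := by
  have : Fact (t ∈ Icc a b) := ⟨ht⟩
  exact intervalIntegral.integral_hasDerivWithinAt_right
    (intervalIntegrable_of_continuousOn_Icc hf ht)
    (hf.stronglyMeasurableAtFilter_nhdsWithin measurableSet_Icc t) (hf t ht)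

lemma continuousOn_integral (hf : ContinuousOn f (Icc a b)) :
    ContinuousOn (fun t => ∫ s in a..t, f s) (Icc a b) :=
  fun _ ht => (hasDerivWithinAt_integral hf ht).continuousWithinAt

lemma eq_add_integral_of_hasDerivWithinAt {f' : ℝ → Y}
    (hf : ∀ t ∈ Icc a b, HasDerivWithinAt f (f' t) (Icc a b) t)
    (hf' : ContinuousOn f' (Icc a b)) (ht : t ∈ Icc a b) :
    f t = f a + ∫ s in a..t, f' s := by
  have hderiv : ∀ s ∈ Ioo a t, HasDerivAt f (f' s) s := fun s hs =>
    (hf s ⟨hs.1.le, hs.2.le.trans ht.2⟩).hasDerivAt (Icc_mem_nhds hs.1 (hs.2.trans_le ht.2))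
  rw [intervalIntegral.integral_eq_sub_of_hasDerivAt_of_le ht.1
    (fun s hs => ((hf s ⟨hs.1, hs.2.trans ht.2⟩).continuousWithinAt.mono
      (Icc_subset_Icc_right ht.2))) hderiv (intervalIntegrable_of_continuousOn_Icc hf' ht)]
  abel

end Calculus

section Jacobian

/-- The derivative `φ' = 1 + ∫ F` of the map `φ` with `φ(0) = 0`, `φ'(0) = 1` and `φ'' = F`. -/
def jac (F : L2) : CI := 1 + primitive F

/-- The reciprocal `1 / φ'` of the derivative, equal to `0` unless `φ'` has no zero. -/
def jacInv (F : L2) : CI := Ring.inverse (jac F)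

/-- The nonlinearity `φ'' / φ'`, that is, the derivative of `log φ'`. -/
def nonlinearity (F : L2) : L2 := jacInv F • F

/-- The derivative of the nonlinearity `φ'' / φ'` in the direction with second derivative `X`. -/
def dNonlinearity (F : L2) : L2 →L[ℝ] L2 :=
  ContinuousLinearMap.lsmul ℝ CI (jacInv F) -
    ((ContinuousLinearMap.lsmul ℝ CI).flip F).comp
      ((ContinuousLinearMap.mul ℝ CI (jacInv F ^ 2)).comp primitive)

/-- The second derivative of `h ∘ φ⁻¹`, pulled back by `φ`, where `F = φ''` and `X = h''`. -/
def pullbackD2 (F X : L2) : L2 := jacInv F • dNonlinearity F X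

lemma ext_jac (F : L2) (x : ℝ) : ext (jac F) x = 1 + ext (primitive F) x := rfl

lemma dNonlinearity_apply (F X : L2) :
    dNonlinearity F X = jacInv F • X - (primitive X * jacInv F ^ 2) • F := by
  simp [dNonlinearity, mul_comm]

variable {F : L2}

lemma jacInv_mul_jac (h : IsUnit (jac F)) : jacInv F * jac F = 1 := Ring.inverse_mul_cancel _ h

lemma jac_mul_jacInv (h : IsUnit (jac F)) : jac F * jacInv F = 1 := Ring.mul_inverse_cancel _ h

lemma jac_smul_pullbackD2 (h : IsUnit (jac F)) (X : L2) :
    jac F • pullbackD2 F X = dNonlinearity F X := by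
  rw [pullbackD2, smul_smul, jac_mul_jacInv h, one_smul]

lemma ext_jacInv_mul_ext_jac (h : IsUnit (jac F)) (x : ℝ) :
    ext (jacInv F) x * ext (jac F) x = 1 :=
  congrFun (congrArg ext (jacInv_mul_jac h)) x

lemma ext_jacInv (h : IsUnit (jac F)) (x : ℝ) : ext (jacInv F) x = (ext (jac F) x)⁻¹ :=
  eq_inv_of_mul_eq_one_left (ext_jacInv_mul_ext_jac h x)

lemma continuous_jac : Continuous jac := by
  unfold jac
  fun_prop

lemma continuousAt_jacInv (h : IsUnit (jac F)) : ContinuousAt jacInv F := by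
  obtain ⟨x, hx⟩ := h
  have hinv := NormedRing.inverse_continuousAt x
  rw [hx] at hinv
  exact hinv.comp continuous_jac.continuousAt

lemma jacInv_toL2_eq {c : CI} (h : IsUnit (jac (toL2 c))) :
    jacInv (toL2 c) = 1 - primitive (jacInv (toL2 c) ^ 2 • toL2 c) := by
  have hderiv : ∀ x ∈ Icc (0 : ℝ) 1, HasDerivWithinAt (ext (jacInv (toL2 c)))
      (ext (-(jacInv (toL2 c) ^ 2 * c)) x) (Icc 0 1) x := by
    intro x hx
    have hjac := (hasDerivWithinAt_ext_primitive_toL2 c hx).const_add 1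
    have hne : ext (jac (toL2 c)) x ≠ 0 :=
      right_ne_zero_of_mul_eq_one (ext_jacInv_mul_ext_jac h x)
    refine ((hjac.fun_inv hne).congr_deriv ?_).congr (fun y _ => ext_jacInv h y) (ext_jacInv h x)
    change -ext c x / ext (jac (toL2 c)) x ^ 2 = -(ext (jacInv (toL2 c)) x ^ 2 * ext c x)
    rw [ext_jacInv h]
    field_simp
  ext x
  have ftc := eq_add_integral_of_hasDerivWithinAt hderiv (continuous_ext _).continuousOn x.2
  have hzero : ext (jacInv (toL2 c)) 0 = 1 := by
    rw [ext_jacInv h, ext_jac, ext_primitive_zero, add_zero, inv_one]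
  rw [hzero, ← primitive_toL2_apply _ x, map_neg, map_neg, toL2_mul, ext_of_mem _ x.2] at ftc
  exact ftc

lemma jacInv_eq (h : IsUnit (jac F)) : jacInv F = 1 - primitive (jacInv F ^ 2 • F) := by
  have hev : ∀ᶠ G in nhds F, IsUnit (jac G) :=
    continuous_jac.continuousAt.eventually (Units.isOpen.mem_nhds h)
  have hfreq : ∃ᶠ G in nhds F, jacInv G = 1 - primitive (jacInv G ^ 2 • G) := by
    refine ((mem_closure_iff_frequently.1 (denseRange_toL2 F)).and_eventually hev).mono ?_
    rintro _ ⟨⟨c, rfl⟩, hc⟩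
    exact jacInv_toL2_eq hc
  have hR := continuousAt_jacInv h
  have hrhs : ContinuousAt (fun G => 1 - primitive (jacInv G ^ 2 • G)) F := by fun_prop
  exact tendsto_nhds_unique_of_frequently_eq hR hrhs hfreq

lemma primitive_dNonlinearity (h : IsUnit (jac F)) (X : L2) :
    primitive (dNonlinearity F X) = primitive X * jacInv F := by
  have hX : jacInv F • X = X - primitive (jacInv F ^ 2 • F) • X := by
    conv_lhs => rw [jacInv_eq h]
    rw [sub_smul, one_smul]
  have hprod : primitive X * jacInv F =
      primitive X - primitive X * primitive (jacInv F ^ 2 • F) := by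
    conv_lhs => rw [jacInv_eq h]
    rw [mul_sub, mul_one]
  rw [hprod, primitive_mul_primitive, dNonlinearity_apply, hX, map_sub, map_sub, smul_smul]
  abel

variable {S : Set ℝ} {t : ℝ}

lemma hasDerivWithinAt_jac {F : ℝ → L2} {F' : L2} (hF : HasDerivWithinAt F F' S t) :
    HasDerivWithinAt (fun s => jac (F s)) (primitive F') S t :=
  (primitive.hasFDerivAt.comp_hasDerivWithinAt t hF).const_add 1

lemma hasDerivWithinAt_jacInv {F : ℝ → L2} {F' : L2} (hF : HasDerivWithinAt F F' S t)
    (hu : IsUnit (jac (F t))) :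
    HasDerivWithinAt (fun s => jacInv (F s)) (-(primitive F' * jacInv (F t) ^ 2)) S t := by
  obtain ⟨x, hx⟩ := hu
  have h := hasFDerivAt_ringInverse (𝕜 := ℝ) x
  rw [hx] at h
  refine (h.comp_hasDerivWithinAt t (hasDerivWithinAt_jac hF)).congr_deriv ?_
  have hinv : jacInv (F t) = ↑x⁻¹ := by rw [jacInv, ← hx, Ring.inverse_unit]
  simp only [neg_apply, ContinuousLinearMap.mulLeftRight_apply, hinv]
  ring

lemma hasDerivWithinAt_nonlinearity {F : ℝ → L2} {F' : L2} (hF : HasDerivWithinAt F F' S t)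
    (hu : IsUnit (jac (F t))) :
    HasDerivWithinAt (fun s => nonlinearity (F s)) (dNonlinearity (F t) F') S t := by
  refine ((hasDerivWithinAt_jacInv hF hu).smul hF).congr_deriv ?_
  rw [dNonlinearity_apply, neg_smul, sub_eq_add_neg]

end Jacobian

section Diffeomorphisms

variable {f : H02} {x : ℝ}

lemma mem_Diff02_iff : f ∈ Diff02 ↔ ∀ x ∈ Icc (0 : ℝ) 1, 0 < ext (jac (D f)) x :=
  forall₂_congr fun x hx => by rw [f.derivWithin_eqOn hx, ext_jac]

lemma isUnit_jac (hf : f ∈ Diff02) : IsUnit (jac (D f)) := by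
  rw [ContinuousMap.isUnit_iff_forall_ne_zero]
  intro x
  rw [← ext_of_mem _ x.2]
  exact (mem_Diff02_iff.1 hf x x.2).ne'

lemma hasDerivWithinAt_toMap (f : H02) (hx : x ∈ Icc (0 : ℝ) 1) :
    HasDerivWithinAt (toMap f) (ext (jac (D f)) x) (Icc 0 1) x :=
  (hasDerivWithinAt_id x _).add (f.hasDerivWithinAt hx)

lemma continuousOn_toMap (f : H02) : ContinuousOn (toMap f) (Icc 0 1) :=
  fun _ hx => (hasDerivWithinAt_toMap f hx).continuousWithinAt

lemma toMap_zero (f : H02) : toMap f 0 = 0 := by simp [toMap, f.prop.2.2.1]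

lemma toMap_one (f : H02) : toMap f 1 = 1 := by simp [toMap, f.prop.2.2.2.1]

lemma toMap_injective : Function.Injective toMap := fun f g h => Subtype.ext <| funext fun x => by
  simpa [toMap] using congrFun h x

lemma strictMonoOn_toMap (hf : f ∈ Diff02) : StrictMonoOn (toMap f) (Icc 0 1) := by
  apply strictMonoOn_of_deriv_pos (convex_Icc 0 1) (continuousOn_toMap f)
  intro x hx
  have hx' := interior_subset hx
  rw [((hasDerivWithinAt_toMap f hx').hasDerivAt (mem_interior_iff_mem_nhds.1 hx)).deriv]
  exact mem_Diff02_iff.1 hf x hx'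

lemma image_toMap_Ioo (hf : f ∈ Diff02) : toMap f '' Ioo 0 1 = Ioo 0 1 := by
  apply subset_antisymm
  · rintro _ ⟨x, hx, rfl⟩
    have hmono := strictMonoOn_toMap hf
    have hx' := Ioo_subset_Icc_self hx
    rw [← toMap_zero f, ← toMap_one f]
    exact ⟨hmono (left_mem_Icc.2 zero_le_one) hx' hx.1,
      hmono hx' (right_mem_Icc.2 zero_le_one) hx.2⟩
  · have := intermediate_value_Ioo zero_le_one (continuousOn_toMap f)
    rwa [toMap_zero, toMap_one] at this

lemma invMap_toMap (hf : f ∈ Diff02) (hx : x ∈ Icc (0 : ℝ) 1) : invMap f (toMap f x) = x :=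
  (strictMonoOn_toMap hf).injOn.leftInvOn_invFunOn hx

lemma invMap_monotoneOn (hf : f ∈ Diff02) : MonotoneOn (invMap f) (Ioo 0 1) := by
  intro y hy y' hy' hyy
  rw [← image_toMap_Ioo hf] at hy hy'
  obtain ⟨x, hx, rfl⟩ := hy
  obtain ⟨x', hx', rfl⟩ := hy'
  rw [invMap_toMap hf (Ioo_subset_Icc_self hx), invMap_toMap hf (Ioo_subset_Icc_self hx')]
  exact ((strictMonoOn_toMap hf).le_iff_le (Ioo_subset_Icc_self hx) (Ioo_subset_Icc_self hx')).1 hyy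

lemma integral_comp_toMap (hf : f ∈ Diff02) (g : ℝ → ℝ) :
    ∫ x, ext (jac (D f)) x * g (toMap f x) ∂μI = ∫ y, g y ∂μI := by
  have h := integral_image_eq_integral_abs_deriv_smul measurableSet_Ioo
    (fun x hx => (hasDerivWithinAt_toMap f (Ioo_subset_Icc_self hx)).mono Ioo_subset_Icc_self)
    ((strictMonoOn_toMap hf).injOn.mono Ioo_subset_Icc_self) g
  rw [image_toMap_Ioo hf] at h
  rw [h]
  apply setIntegral_congr_fun measurableSet_Ioo
  intro x hx
  simp only [smul_eq_mul, abs_of_pos (mem_Diff02_iff.1 hf x (Ioo_subset_Icc_self hx))]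

lemma integrable_comp_toMap (hf : f ∈ Diff02) (g : ℝ → ℝ) :
    Integrable (fun x => ext (jac (D f)) x * g (toMap f x)) μI ↔ Integrable g μI := by
  have h := integrableOn_image_iff_integrableOn_abs_deriv_smul measurableSet_Ioo
    (fun x hx => (hasDerivWithinAt_toMap f (Ioo_subset_Icc_self hx)).mono Ioo_subset_Icc_self)
    ((strictMonoOn_toMap hf).injOn.mono Ioo_subset_Icc_self) g
  rw [image_toMap_Ioo hf] at h
  rw [← IntegrableOn, ← IntegrableOn, h]
  apply integrableOn_congr_fun _ measurableSet_Ioo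
  intro x hx
  simp only [smul_eq_mul, abs_of_pos (mem_Diff02_iff.1 hf x (Ioo_subset_Icc_self hx))]

lemma integral_comp_invMap_mul (hf : f ∈ Diff02) (p k : ℝ → ℝ) :
    ∫ y, (p ∘ invMap f) y * k y ∂μI =
      ∫ x, ext (jac (D f)) x * (p x * k (toMap f x)) ∂μI := by
  rw [← integral_comp_toMap hf]
  apply setIntegral_congr_fun measurableSet_Ioo
  intro x hx
  simp only [Function.comp_apply, invMap_toMap hf (Ioo_subset_Icc_self hx)]

lemma memLp_comp_invMap (hf : f ∈ Diff02) (u : L2) : MemLp (u ∘ invMap f) 2 μI := by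
  have hmeas : AEStronglyMeasurable (u ∘ invMap f) μI :=
    ((Lp.stronglyMeasurable u).measurable.comp_aemeasurable
      (aemeasurable_restrict_of_monotoneOn measurableSet_Ioo
        (invMap_monotoneOn hf))).aestronglyMeasurable
  rw [memLp_two_iff_integrable_sq hmeas, ← integrable_comp_toMap hf]
  refine ((L2.integrable_mul (jac (D f) • u) u)).congr ?_
  filter_upwards [coeFn_smul (jac (D f)) u, ae_restrict_mem measurableSet_Ioo] with x hu hx
  rw [Function.comp_apply, invMap_toMap hf (Ioo_subset_Icc_self hx), hu, sq, mul_assoc]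

lemma IsTest.integral_jac_mul_deriv_comp_toMap {ψ : ℝ → ℝ} (hψ : IsTest ψ) (f : H02)
    (hx : x ∈ Icc (0 : ℝ) 1) :
    ∫ y in (0 : ℝ)..x, ext (jac (D f)) y * _root_.deriv ψ (toMap f y) = ψ (toMap f x) := by
  have hderiv : ∀ y ∈ Icc (0 : ℝ) 1, HasDerivWithinAt (fun y => ψ (toMap f y))
      (ext (jac (D f)) y * _root_.deriv ψ (toMap f y)) (Icc 0 1) y := fun y hy => by
    rw [mul_comm]
    exact (hψ.hasDerivAt _).comp_hasDerivWithinAt y (hasDerivWithinAt_toMap f hy)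
  have hcont := (continuous_ext (jac (D f))).continuousOn.mul
    (hψ.deriv.smooth.continuous.comp_continuousOn (continuousOn_toMap f))
  rw [eq_add_integral_of_hasDerivWithinAt hderiv hcont hx, toMap_zero, hψ.apply_zero, zero_add]

lemma isWeakDeriv_comp_invMap (hf : f ∈ Diff02) {p q : ℝ → ℝ} {u : L2}
    (hp : p =ᵐ[μI] ext (primitive u)) (hq : (fun x => ext (jac (D f)) x * q x) =ᵐ[μI] u) :
    IsWeakDeriv 1 (p ∘ invMap f) (q ∘ invMap f) := by
  intro ψ hψ
  set g : ℝ → ℝ := fun x => ext (jac (D f)) x * deriv ψ (toMap f x)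
  have hg : ContinuousOn g (Icc 0 1) := (continuous_ext _).continuousOn.mul
    (hψ.deriv.smooth.continuous.comp_continuousOn (continuousOn_toMap f))
  have hgi : Integrable g μI := (memLp_of_continuousOn hg).integrable (by norm_num)
  have hψφ : MemLp (fun x => ψ (toMap f x)) 2 μI := memLp_of_continuousOn
    (hψ.smooth.continuous.comp_continuousOn (continuousOn_toMap f))
  have parts := primitive_mul_primitive_apply u.integrable hgi (right_mem_Icc.2 zero_le_one)
  rw [hψ.integral_jac_mul_deriv_comp_toMap f (right_mem_Icc.2 zero_le_one), toMap_one,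
    hψ.apply_one, mul_zero, ← integral_μI] at parts
  have hsum : ∫ x, u x * (∫ s in (0 : ℝ)..x, g s) + (∫ s in (0 : ℝ)..x, u s) * g x ∂μI =
      ∫ x, u x * ψ (toMap f x) + ext (primitive u) x * g x ∂μI := by
    apply setIntegral_congr_fun measurableSet_Ioo
    intro x hx
    simp only [ext_primitive _ (Ioo_subset_Icc_self hx), g,
      hψ.integral_jac_mul_deriv_comp_toMap f (Ioo_subset_Icc_self hx)]
  have hi₁ : Integrable (fun x => u x * ψ (toMap f x)) μI := (Lp.memLp u).integrable_mul hψφ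
  have hi₂ : Integrable (fun x => ext (primitive u) x * g x) μI :=
    (memLp_ext _).integrable_mul (memLp_of_continuousOn hg)
  rw [hsum, integral_add hi₁ hi₂] at parts
  have hp' : ∫ x, ext (jac (D f)) x * (p x * deriv ψ (toMap f x)) ∂μI =
      ∫ x, ext (primitive u) x * g x ∂μI :=
    integral_congr_ae (hp.mono fun x h => by simp only [h, g]; ring)
  have hq' : ∫ x, ext (jac (D f)) x * (q x * ψ (toMap f x)) ∂μI =
      ∫ x, u x * ψ (toMap f x) ∂μI :=
    integral_congr_ae (hq.mono fun x h => by simp only [← h]; ring)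
  rw [iteratedDeriv_one, integral_comp_invMap_mul hf, integral_comp_invMap_mul hf, hp', hq']
  linarith

end Diffeomorphisms

section Metric

variable {f : H02}

lemma isWeakDeriv_two_comp_invMap (hf : f ∈ Diff02) (h : H02) :
    IsWeakDeriv 2 (h ∘ invMap f) (pullbackD2 (D f) (D h) ∘ invMap f) := by
  have hu := isUnit_jac hf
  have hfirst : IsWeakDeriv 1 (h ∘ invMap f)
      (ext (primitive (D h) * jacInv (D f)) ∘ invMap f) := by
    apply isWeakDeriv_comp_invMap hf (ae_eq_of_eqOn_Icc h.eqOn_ext_primitive)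
    filter_upwards [coeFn_toL2 (primitive (D h))] with x hx
    have hmul : ext (primitive (D h) * jacInv (D f)) x =
      ext (primitive (D h)) x * ext (jacInv (D f)) x := rfl
    rw [hx, hmul]
    linear_combination ext (primitive (D h)) x * ext_jacInv_mul_ext_jac hu x
  have hsecond : IsWeakDeriv 1 (ext (primitive (D h) * jacInv (D f)) ∘ invMap f)
      (pullbackD2 (D f) (D h) ∘ invMap f) := by
    apply isWeakDeriv_comp_invMap hf (u := dNonlinearity (D f) (D h))
    · rw [primitive_dNonlinearity hu]
    · rw [← jac_smul_pullbackD2 hu]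
      exact (coeFn_smul _ _).symm
  exact hfirst.succ hsecond

/-- The metric of the vector with second derivative `X` with itself, at the diffeomorphism with
second derivative `F`. -/
def energyDensity (F X : L2) : ℝ := inner ℝ (dNonlinearity F X) (pullbackD2 F X)

lemma metricG_self (hf : f ∈ Diff02) (h : H02) :
    metricG f h h = energyDensity (D f) (D h) := by
  set w := pullbackD2 (D f) (D h)
  have hm := memLp_comp_invMap hf w
  have hw : IsWeakDeriv 2 (h ∘ invMap f) (hm.toLp _) :=
    (isWeakDeriv_two_comp_invMap hf h).congr hm.coeFn_toLp.symm
  have hd : weakD2 (h ∘ invMap f) = hm.toLp _ := by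
    have hex : ∃ g : L2, IsWeakDeriv 2 (h ∘ invMap f) g := ⟨_, hw⟩
    rw [weakD2, dif_pos hex]
    exact weakD2_unique hex.choose_spec hw
  have hsq : ∫ x, (hm.toLp _ : L2) x * (hm.toLp _ : L2) x ∂μI =
      ∫ x, (w ∘ invMap f) x * (w ∘ invMap f) x ∂μI :=
    integral_congr_ae (hm.coeFn_toLp.mono fun x hx => by simp only [hx])
  rw [metricG, innerH02, hd, hsq, integral_comp_invMap_mul hf, energyDensity,
    ← jac_smul_pullbackD2 (isUnit_jac hf), inner_eq_intervalIntegral, ← integral_μI]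
  apply integral_congr_ae
  filter_upwards [coeFn_smul (jac (D f)) w, ae_restrict_mem measurableSet_Ioo] with x hx hx'
  rw [hx, Function.comp_apply, invMap_toMap hf (Ioo_subset_Icc_self hx'), mul_assoc]

end Metric

section EnergyVariation

variable {F : L2}

lemma continuousAt_dNonlinearity (h : IsUnit (jac F)) : ContinuousAt dNonlinearity F := by
  have hR := continuousAt_jacInv h
  have hR' : ContinuousAt (fun G => ContinuousLinearMap.mul ℝ CI (jacInv G ^ 2)) F :=
    (ContinuousLinearMap.mul ℝ CI).continuous.continuousAt.comp (hR.pow 2)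
  exact ((ContinuousLinearMap.lsmul ℝ CI).continuous.continuousAt.comp hR).sub
    ((ContinuousLinearMap.lsmul ℝ CI).flip.continuous.continuousAt.clm_comp
      (hR'.clm_comp continuousAt_const))

variable {p : L2 × L2}

lemma continuousAt_pullbackD2 (h : IsUnit (jac p.1)) :
    ContinuousAt (fun p : L2 × L2 => pullbackD2 p.1 p.2) p := by
  have hR : ContinuousAt (fun p : L2 × L2 => jacInv p.1) p :=
    (continuousAt_jacInv h).comp continuousAt_fst
  have hz : ContinuousAt (fun p : L2 × L2 => dNonlinearity p.1) p :=
    (continuousAt_dNonlinearity h).comp continuousAt_fst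
  exact hR.smul (hz.clm_apply continuousAt_snd)

/-- Half the derivative of the energy density at `(F, X)` with respect to the velocity `X`. -/
def momentum (F X : L2) : L2 →L[ℝ] ℝ := (innerSL ℝ (pullbackD2 F X)).comp (dNonlinearity F)

/-- Minus half the derivative of the energy density at `(F, X)` with respect to the position `F`. -/
def force (F X : L2) : L2 →L[ℝ] ℝ :=
  (innerSL ℝ (pullbackD2 F X)).comp
    ((ContinuousLinearMap.lsmul ℝ CI (primitive X * jacInv F)).comp (dNonlinearity F) +
      (3 / 2 : ℝ) • ((ContinuousLinearMap.lsmul ℝ CI).flip (pullbackD2 F X)).comp primitive)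

lemma momentum_apply (F X k : L2) :
    momentum F X k = inner ℝ (pullbackD2 F X) (dNonlinearity F k) := rfl

lemma force_apply (F X h : L2) :
    force F X h = inner ℝ (pullbackD2 F X) ((primitive X * jacInv F) • dNonlinearity F h) +
      3 / 2 * inner ℝ (pullbackD2 F X) (primitive h • pullbackD2 F X) := by
  simp [force]

lemma continuousAt_energyDensity (h : IsUnit (jac p.1)) :
    ContinuousAt (fun p : L2 × L2 => energyDensity p.1 p.2) p := by
  have hz : ContinuousAt (fun p : L2 × L2 => dNonlinearity p.1) p :=
    (continuousAt_dNonlinearity h).comp continuousAt_fst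
  exact (hz.clm_apply continuousAt_snd).inner (continuousAt_pullbackD2 h)

lemma continuousAt_momentum (h : IsUnit (jac p.1)) :
    ContinuousAt (fun p : L2 × L2 => momentum p.1 p.2) p := by
  have hz : ContinuousAt (fun p : L2 × L2 => dNonlinearity p.1) p :=
    (continuousAt_dNonlinearity h).comp continuousAt_fst
  exact ((innerSL ℝ).continuous.continuousAt.comp (continuousAt_pullbackD2 h)).clm_comp hz

lemma continuousAt_force (h : IsUnit (jac p.1)) :
    ContinuousAt (fun p : L2 × L2 => force p.1 p.2) p := by
  have hw := continuousAt_pullbackD2 h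
  have hz : ContinuousAt (fun p : L2 × L2 => dNonlinearity p.1) p :=
    (continuousAt_dNonlinearity h).comp continuousAt_fst
  have hR : ContinuousAt (fun p : L2 × L2 => jacInv p.1) p :=
    (continuousAt_jacInv h).comp continuousAt_fst
  have hVR : ContinuousAt (fun p : L2 × L2 => primitive p.2 * jacInv p.1) p := by fun_prop
  have hlsmul : ContinuousAt (fun p : L2 × L2 =>
      ContinuousLinearMap.lsmul ℝ CI (E := L2) (primitive p.2 * jacInv p.1)) p :=
    (ContinuousLinearMap.lsmul ℝ CI).continuous.continuousAt.comp hVR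
  have hflip : ContinuousAt (fun p : L2 × L2 =>
      (ContinuousLinearMap.lsmul ℝ CI).flip (pullbackD2 p.1 p.2)) p :=
    (ContinuousLinearMap.lsmul ℝ CI).flip.continuous.continuousAt.comp hw
  exact ((innerSL ℝ).continuous.continuousAt.comp hw).clm_comp
    ((hlsmul.clm_comp hz).add ((hflip.clm_comp continuousAt_const).const_smul (3 / 2 : ℝ)))

variable {F X : ℝ → L2} {F' X' : L2} {S : Set ℝ} {t : ℝ}

lemma hasDerivWithinAt_dNonlinearity (hF : HasDerivWithinAt F F' S t)
    (hX : HasDerivWithinAt X X' S t) (hu : IsUnit (jac (F t))) :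
    HasDerivWithinAt (fun s => dNonlinearity (F s) (X s))
      (dNonlinearity (F t) X' - (primitive F' * jacInv (F t)) • dNonlinearity (F t) (X t) -
        (primitive (X t) * jacInv (F t)) • dNonlinearity (F t) F') S t := by
  have hR := hasDerivWithinAt_jacInv hF hu
  have hVX : HasDerivWithinAt (fun s => primitive (X s)) (primitive X') S t :=
    primitive.hasFDerivAt.comp_hasDerivWithinAt t hX
  have hz := (hR.smul hX).fun_sub ((hVX.fun_mul (hR.fun_pow 2)).smul hF)
  simp only [dNonlinearity_apply]
  refine hz.congr_deriv ?_
  module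

lemma hasDerivWithinAt_energyDensity (hF : HasDerivWithinAt F F' S t)
    (hX : HasDerivWithinAt X X' S t) (hu : IsUnit (jac (F t))) :
    HasDerivWithinAt (fun s => energyDensity (F s) (X s))
      (2 * (momentum (F t) (X t) X' - force (F t) (X t) F')) S t := by
  set z := dNonlinearity (F t)
  set w := pullbackD2 (F t) (X t)
  have hz := hasDerivWithinAt_dNonlinearity hF hX hu
  refine (hz.inner ℝ ((hasDerivWithinAt_jacInv hF hu).smul hz)).congr_deriv ?_
  have hRz (c : CI) : (c * jacInv (F t)) • z (X t) = c • w := by rw [mul_smul]; rfl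
  have hRR : (primitive F' * jacInv (F t) ^ 2) • z (X t) =
      jacInv (F t) • primitive F' • w := by
    rw [← hRz, smul_smul]
    congr 1
    ring
  have hRX : ((fun s => jacInv (F s)) • fun s => dNonlinearity (F s) (X s)) t = w := rfl
  have hR : jacInv (F t) • z (X t) = w := rfl
  rw [hRX, neg_smul, hRR, hRz, inner_add_right, inner_neg_right, ← inner_smul_comm,
    ← inner_smul_comm, hR, momentum_apply, force_apply, real_inner_comm w,
    inner_sub_right, inner_sub_right]
  ring

end EnergyVariation

section EulerLagrange

lemma hasDerivAt_integral_of_continuousOn {Y : Type*} [NormedAddCommGroup Y] [NormedSpace ℝ Y]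
    {f f' : ℝ → ℝ → Y} {K : Set ℝ} {s₀ a b : ℝ} (hab : a ≤ b) (hK : IsCompact K)
    (hs₀ : K ∈ 𝓝 s₀) (hf : ∀ s ∈ K, ContinuousOn (f s) (Icc a b))
    (hf' : ContinuousOn (fun p : ℝ × ℝ => f' p.1 p.2) (K ×ˢ Icc a b))
    (hderiv : ∀ s ∈ K, ∀ t ∈ Icc a b, HasDerivAt (fun s => f s t) (f' s t) s) :
    HasDerivAt (fun s => ∫ t in a..b, f s t) (∫ t in a..b, f' s₀ t) s₀ := by
  have hs₀K := mem_of_mem_nhds hs₀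
  obtain ⟨C, hC⟩ := (hK.prod isCompact_Icc).exists_bound_of_continuousOn hf'
  have hsub : uIoc a b ⊆ Icc a b := by
    rw [uIoc_of_le hab]
    exact Ioc_subset_Icc_self
  have hmeas {g : ℝ → Y} (hg : ContinuousOn g (Icc a b)) :
      AEStronglyMeasurable g (volume.restrict (uIoc a b)) :=
    (hg.mono hsub).aestronglyMeasurable measurableSet_uIoc
  have hf's₀ : ContinuousOn (f' s₀) (Icc a b) :=
    hf'.comp (f := fun t => (s₀, t)) (by fun_prop) fun t ht => ⟨hs₀K, ht⟩
  exact (intervalIntegral.hasDerivAt_integral_of_dominated_loc_of_deriv_le (bound := fun _ => C) hs₀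
    (Filter.eventually_of_mem hs₀ fun s hs => hmeas (hf s hs))
    (intervalIntegrable_of_continuousOn_Icc (hf s₀ hs₀K) (right_mem_Icc.2 hab)) (hmeas hf's₀)
    (.of_forall fun t ht s hs => hC (s, t) ⟨hs, hsub ht⟩) intervalIntegrable_const
    (.of_forall fun t ht s hs => hderiv s hs t (hsub ht))).2

lemma hasDerivAt_integral_energyDensity {F X h k : ℝ → L2} (hF : ContinuousOn F (Icc 0 1))
    (hX : ContinuousOn X (Icc 0 1)) (hh : ContinuousOn h (Icc 0 1))
    (hk : ContinuousOn k (Icc 0 1))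
    (hu : ∀ᶠ s in 𝓝 (0 : ℝ), ∀ t ∈ Icc (0 : ℝ) 1, IsUnit (jac (F t + s • h t))) :
    HasDerivAt (fun s : ℝ => ∫ t in (0 : ℝ)..1, energyDensity (F t + s • h t) (X t + s • k t))
      (∫ t in (0 : ℝ)..1, 2 * (momentum (F t) (X t) (k t) - force (F t) (X t) (h t))) 0 := by
  obtain ⟨δ, hδ, hunit⟩ := Metric.nhds_basis_closedBall.mem_iff.1 hu
  set K := Metric.closedBall (0 : ℝ) δ
  have hsnd {g : ℝ → L2} (hg : ContinuousOn g (Icc 0 1)) :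
      ContinuousOn (fun p : ℝ × ℝ => g p.2) (K ×ˢ Icc 0 1) :=
    hg.comp continuousOn_snd fun p hp => hp.2
  set P : ℝ × ℝ → L2 × L2 := fun p => (F p.2 + p.1 • h p.2, X p.2 + p.1 • k p.2)
  have hP : ContinuousOn P (K ×ˢ Icc 0 1) :=
    ((hsnd hF).add (continuousOn_fst.smul (hsnd hh))).prodMk
      ((hsnd hX).add (continuousOn_fst.smul (hsnd hk)))
  have hcomp {Y : Type} [TopologicalSpace Y] {g : L2 × L2 → Y}
      (hg : ∀ p : L2 × L2, IsUnit (jac p.1) → ContinuousAt g p) :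
      ContinuousOn (fun p => g (P p)) (K ×ˢ Icc 0 1) := fun p hp =>
    (hg _ (hunit hp.1 p.2 hp.2)).comp_continuousWithinAt (hP p hp)
  have hdens : ContinuousOn (fun p => energyDensity (P p).1 (P p).2) (K ×ˢ Icc 0 1) :=
    hcomp fun _ => continuousAt_energyDensity
  have hmom : ContinuousOn (fun p => momentum (P p).1 (P p).2) (K ×ˢ Icc 0 1) :=
    hcomp fun _ => continuousAt_momentum
  have hforce : ContinuousOn (fun p => force (P p).1 (P p).2) (K ×ˢ Icc 0 1) :=
    hcomp fun _ => continuousAt_force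
  have hvar : ContinuousOn (fun p : ℝ × ℝ => 2 * (momentum (P p).1 (P p).2 (k p.2) -
      force (P p).1 (P p).2 (h p.2))) (K ×ˢ Icc 0 1) :=
    continuousOn_const.mul ((hmom.clm_apply (hsnd hk)).sub (hforce.clm_apply (hsnd hh)))
  have hline (u v : L2) (s : ℝ) : HasDerivWithinAt (fun r : ℝ => u + r • v) v univ s := by
    simpa using ((hasDerivAt_id' s).smul_const v).const_add u
  have hslice : ∀ s ∈ K,
      ContinuousOn (fun t => energyDensity (P (s, t)).1 (P (s, t)).2) (Icc 0 1) :=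
    fun s hs => hdens.comp (f := fun t => (s, t)) (by fun_prop) fun t ht => ⟨hs, ht⟩
  have hderiv : ∀ s ∈ K, ∀ t ∈ Icc (0 : ℝ) 1,
      HasDerivAt (fun s => energyDensity (P (s, t)).1 (P (s, t)).2)
        (2 * (momentum (P (s, t)).1 (P (s, t)).2 (k t) -
          force (P (s, t)).1 (P (s, t)).2 (h t))) s := fun s hs t ht =>
    (hasDerivWithinAt_energyDensity (hline (F t) (h t) s) (hline (X t) (k t) s)
      (hunit hs t ht)).hasDerivAt Filter.univ_mem
  have hint := hasDerivAt_integral_of_continuousOn zero_le_one (isCompact_closedBall 0 δ)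
    (Metric.closedBall_mem_nhds 0 hδ) (f := fun s t => energyDensity (P (s, t)).1 (P (s, t)).2)
    (f' := fun s t => 2 * (momentum (P (s, t)).1 (P (s, t)).2 (k t) -
      force (P (s, t)).1 (P (s, t)).2 (h t))) hslice hvar hderiv
  simpa only [P, zero_smul, add_zero] using hint

lemma isOpen_Diff02 : IsOpen Diff02 := by
  have hpre : Diff02 = (fun f => jac (D f)) ⁻¹' {c : CI | MapsTo c univ (Ioi 0)} := by
    ext f
    rw [mem_Diff02_iff]
    constructor
    · intro h x _
      rw [mem_Ioi, ← ext_of_mem _ x.2]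
      exact h x x.2
    · intro h x hx
      rw [ext_of_mem _ hx]
      exact h (mem_univ _)
  rw [hpre]
  exact (ContinuousMap.isOpen_setOfPred_mapsTo isCompact_univ isOpen_Ioi).preimage
    (continuous_jac.comp D.continuous)

lemma eventually_add_smul_mem_Diff02 {γ h : ℝ → H02} (hγ : ContinuousOn γ (Icc 0 1))
    (hmem : ∀ t ∈ Icc (0 : ℝ) 1, γ t ∈ Diff02) (hh : Continuous h) :
    ∀ᶠ s in 𝓝 (0 : ℝ), ∀ t ∈ Icc (0 : ℝ) 1, γ t + s • h t ∈ Diff02 := by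
  set γ' : ℝ → H02 := IccExtend zero_le_one ((Icc (0 : ℝ) 1).domRestrict γ)
  have hγ' : Continuous γ' := (continuousOn_iff_continuous_domRestrict.1 hγ).Icc_extend'
  have heq {t : ℝ} (ht : t ∈ Icc (0 : ℝ) 1) : γ' t = γ t := IccExtend_of_mem _ _ ht
  have hcont : Continuous fun p : ℝ × ℝ => γ' p.2 + p.1 • h p.2 := by fun_prop
  have hev := isCompact_Icc.eventually_forall_of_forall_eventually (x₀ := (0 : ℝ))
    (K := Icc (0 : ℝ) 1) (P := fun s t => γ' t + s • h t ∈ Diff02) fun t ht =>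
      hcont.continuousAt.eventually_mem (isOpen_Diff02.mem_nhds (by
        simpa only [zero_smul, add_zero, heq ht] using hmem t ht))
  filter_upwards [hev] with s hs t ht
  rw [← heq ht]
  exact hs t ht

variable {γ : ℝ → H02} {t : ℝ}

namespace IsGeodesic

lemma hasDerivWithinAt (hγ : IsGeodesic γ) (ht : t ∈ Icc (0 : ℝ) 1) :
    HasDerivWithinAt γ (velocity γ t) (Icc 0 1) t :=
  (hγ.contDiff.differentiableOn one_ne_zero t ht).hasDerivWithinAt

lemma isUnit_jac (hγ : IsGeodesic γ) (ht : t ∈ Icc (0 : ℝ) 1) : IsUnit (jac (D (γ t))) :=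
  SobolevDiff.isUnit_jac (hγ.mem t ht)

lemma hasDerivWithinAt_D (hγ : IsGeodesic γ) (ht : t ∈ Icc (0 : ℝ) 1) :
    HasDerivWithinAt (fun t => D (γ t)) (D (velocity γ t)) (Icc 0 1) t :=
  D.toContinuousLinearMap.hasFDerivAt.comp_hasDerivWithinAt t (hγ.hasDerivWithinAt ht)

lemma continuousOn_D (hγ : IsGeodesic γ) : ContinuousOn (fun t => D (γ t)) (Icc 0 1) :=
  fun _ ht => (hγ.hasDerivWithinAt_D ht).continuousWithinAt

lemma continuousOn_D_velocity (hγ : IsGeodesic γ) :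
    ContinuousOn (fun t => D (velocity γ t)) (Icc 0 1) :=
  D.continuous.comp_continuousOn
    (hγ.contDiff.continuousOn_derivWithin (uniqueDiffOn_Icc zero_lt_one) le_rfl)

lemma continuousOn_comp_D {Y : Type*} [TopologicalSpace Y] {g : L2 × L2 → Y} (hγ : IsGeodesic γ)
    (hg : ∀ p : L2 × L2, IsUnit (jac p.1) → ContinuousAt g p) :
    ContinuousOn (fun t => g (D (γ t), D (velocity γ t))) (Icc 0 1) := fun t ht =>
  (hg _ (hγ.isUnit_jac ht)).comp_continuousWithinAt
    ((hγ.continuousOn_D t ht).prodMk (hγ.continuousOn_D_velocity t ht))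

lemma energy_add_smul (hγ : IsGeodesic γ) {h : ℝ → H02} (hh : Differentiable ℝ h) {s : ℝ}
    (hmem : ∀ t ∈ Icc (0 : ℝ) 1, γ t + s • h t ∈ Diff02) :
    energy (fun t => γ t + s • h t) = 1 / 2 * ∫ t in (0 : ℝ)..1,
      energyDensity (D (γ t) + s • D (h t)) (D (velocity γ t) + s • D (deriv h t)) := by
  rw [energy]
  congr 1
  apply intervalIntegral.integral_congr
  intro t ht
  rw [uIcc_of_le zero_le_one] at ht
  have hv : velocity (fun t => γ t + s • h t) t = velocity γ t + s • deriv h t :=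
    ((hγ.hasDerivWithinAt ht).add
      (((hh t).hasDerivAt.const_smul s).hasDerivWithinAt)).derivWithin
      (uniqueDiffOn_Icc zero_lt_one t ht)
  simp only [metricG_self (hmem t ht), hv, map_add, map_smul]

lemma integral_momentum_sub_force (hγ : IsGeodesic γ) {h : ℝ → H02} (hh : ContDiff ℝ ∞ h)
    (h0 : h 0 = 0) (h1 : h 1 = 0) :
    ∫ t in (0 : ℝ)..1, (momentum (D (γ t)) (D (velocity γ t)) (D (deriv h t)) -
      force (D (γ t)) (D (velocity γ t)) (D (h t))) = 0 := by
  have hh' : Continuous (deriv h) := hh.continuous_deriv (by exact_mod_cast le_top)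
  have hmem := eventually_add_smul_mem_Diff02 hγ.contDiff.continuousOn hγ.mem hh.continuous
  have hint := hasDerivAt_integral_energyDensity hγ.continuousOn_D hγ.continuousOn_D_velocity
    (D.continuous.comp hh.continuous).continuousOn (D.continuous.comp hh').continuousOn
    (hmem.mono fun s hs t ht => by
      have := SobolevDiff.isUnit_jac (hs t ht)
      rwa [map_add, map_smul] at this)
  have henergy := hmem.mono fun s hs => hγ.energy_add_smul (hh.differentiable (by simp)) hs
  have hzero := ((hγ.critical h hh h0 h1).congr_of_eventuallyEq
    (Filter.EventuallyEq.symm henergy)).unique (hint.const_mul (1 / 2))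
  rw [intervalIntegral.integral_const_mul] at hzero
  simp only [Function.comp_apply] at hzero
  linarith

end IsGeodesic

end EulerLagrange

section EulerianForm

lemma eq_add_integral_of_integral_deriv_mul_add_eq_zero {α β : ℝ → ℝ}
    (hα : ContinuousOn α (Icc 0 1)) (hβ : ContinuousOn β (Icc 0 1))
    (h : ∀ ψ, IsTest ψ → ∫ t in (0 : ℝ)..1, (deriv ψ t * α t + ψ t * β t) = 0)
    {t : ℝ} (ht : t ∈ Icc (0 : ℝ) 1) : α t = α 0 + ∫ s in (0 : ℝ)..t, β s := by
  have hβLp := memLp_of_continuousOn hβ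
  have hweak : IsWeakDeriv 1 α (hβLp.toLp β : L2) := by
    refine IsWeakDeriv.congr (fun ψ hψ => ?_) hβLp.coeFn_toLp.symm
    have hint := h ψ hψ
    simp only [mul_comm (deriv ψ _), mul_comm (ψ _)] at hint
    rw [← integral_μI, integral_add (integrable_mul_test (memLp_of_continuousOn hα) hψ.deriv)
      (integrable_mul_test hβLp hψ)] at hint
    rw [iteratedDeriv_one]
    linarith
  obtain ⟨c, hc⟩ := (isWeakDeriv_one_iff (memLp_of_continuousOn hα)).1 hweak
  have heq : ∀ t ∈ Icc (0 : ℝ) 1, α t = c + ∫ s in (0 : ℝ)..t, β s := by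
    intro t ht
    refine (eqOn_Icc_of_ae_eq hα (continuousOn_const.add (continuous_ext _).continuousOn)
      hc ht).trans ?_
    rw [Pi.add_apply, ext_primitive _ ht, intervalIntegral_congr_ae_μI hβLp.coeFn_toLp ht]
  rw [heq t ht, heq 0 (left_mem_Icc.2 zero_le_one), intervalIntegral.integral_same, add_zero]

lemma exists_hasDerivWithinAt_of_D {h : ℝ → H02} {H' : L2} {t : ℝ} (ht : t ∈ Icc (0 : ℝ) 1)
    (hD : HasDerivWithinAt (fun s => D (h s)) H' (Icc 0 1) t) :
    ∃ h', D h' = H' ∧ HasDerivWithinAt h h' (Icc 0 1) t := by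
  have hzero {ℓ : L2 →L[ℝ] ℝ} (hℓ : ∀ f, ℓ (D f) = 0) : ℓ H' = 0 := by
    have hder := ℓ.hasFDerivAt.comp_hasDerivWithinAt t hD
    simp only [Function.comp_def, hℓ] at hder
    exact (uniqueDiffOn_Icc zero_lt_one t ht).eq_deriv _ hder (hasDerivWithinAt_const ..)
  obtain ⟨h', rfl⟩ := exists_D_eq
    (hzero (ℓ := (ContinuousMap.evalCLM ℝ 1).comp primitive) H02.primitive_D_one)
    (hzero (ℓ := ((ContinuousMap.evalCLM ℝ 1).comp primitive).comp (toL2.comp primitive))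
      H02.primitive_toL2_primitive_D_one)
  refine ⟨h', rfl, ?_⟩
  rw [hasDerivWithinAt_iff_isLittleO] at hD ⊢
  refine (Asymptotics.isLittleO_norm_left.2 hD).congr_left (fun s => ?_) |>.of_norm_left
  rw [← map_sub, ← map_smul, ← map_sub, D.norm_map]

lemma primitive_jac_smul_add (F κ : L2) :
    primitive (jac F • κ + primitive κ • F) = jac F * primitive κ := by
  rw [jac, add_smul, one_smul, map_add, map_add, add_mul, one_mul, mul_comm (primitive F),
    primitive_mul_primitive]
  abel

lemma dNonlinearity_jac_smul_add {F : L2} (κ : L2) (h : IsUnit (jac F)) :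
    dNonlinearity F (jac F • κ + primitive κ • F) = κ := by
  have hR : jac F * primitive κ * jacInv F ^ 2 =
      jacInv F * primitive κ * (jacInv F * jac F) := by ring
  rw [dNonlinearity_apply, primitive_jac_smul_add, hR, smul_add, smul_smul, smul_smul,
    jacInv_mul_jac h, one_smul, mul_one, add_sub_cancel_right]

lemma dNonlinearity_primitive_smul_add (F X κ : L2) :
    dNonlinearity F (primitive X • κ + primitive κ • X) =
      (primitive X * jacInv F) • κ + primitive κ • dNonlinearity F X := by
  rw [dNonlinearity_apply, dNonlinearity_apply, add_comm (primitive X • κ), map_add,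
    ← primitive_mul_primitive]
  module

namespace IsGeodesic

variable {γ : ℝ → H02} {t : ℝ}

lemma momentum_eq_add_integral (hγ : IsGeodesic γ) (g : H02) (ht : t ∈ Icc (0 : ℝ) 1) :
    momentum (D (γ t)) (D (velocity γ t)) (D g) =
      momentum (D (γ 0)) (D (velocity γ 0)) (D g) +
        ∫ s in (0 : ℝ)..t, -force (D (γ s)) (D (velocity γ s)) (D g) := by
  refine eq_add_integral_of_integral_deriv_mul_add_eq_zero
    (α := fun t => momentum (D (γ t)) (D (velocity γ t)) (D g))
    (β := fun t => -force (D (γ t)) (D (velocity γ t)) (D g))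
    ((hγ.continuousOn_comp_D fun _ => continuousAt_momentum).clm_apply continuousOn_const)
    ((hγ.continuousOn_comp_D fun _ => continuousAt_force).clm_apply continuousOn_const).neg
    (fun ψ hψ => ?_) ht
  have hderiv : deriv (fun t => ψ t • g) = fun t => deriv ψ t • g := by
    funext t
    exact ((hψ.smooth.differentiable (by simp) t).hasDerivAt.smul_const g).deriv
  have hcrit := hγ.integral_momentum_sub_force (hψ.smooth.smul (contDiff_const (c := g)))
    (by rw [Pi.smul_apply', hψ.apply_zero, zero_smul])
    (by rw [Pi.smul_apply', hψ.apply_one, zero_smul])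
  change ∫ t in (0 : ℝ)..1, (momentum _ _ (D (deriv (fun t => ψ t • g) t)) -
    force _ _ (D (ψ t • g))) = 0 at hcrit
  simpa only [hderiv, map_smul, smul_eq_mul, mul_neg, ← sub_eq_add_neg] using hcrit

lemma hasDerivWithinAt_momentum (hγ : IsGeodesic γ) (ht : t ∈ Icc (0 : ℝ) 1) :
    HasDerivWithinAt
      (fun t => (momentum (D (γ t)) (D (velocity γ t))).comp D.toContinuousLinearMap)
      (-(force (D (γ t)) (D (velocity γ t))).comp D.toContinuousLinearMap) (Icc 0 1) t := by
  have hforce : ContinuousOn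
      (fun t => -(force (D (γ t)) (D (velocity γ t))).comp D.toContinuousLinearMap) (Icc 0 1) :=
    ((hγ.continuousOn_comp_D fun _ => continuousAt_force).clm_comp continuousOn_const).neg
  refine ((hasDerivWithinAt_integral hforce ht).const_add
    ((momentum (D (γ 0)) (D (velocity γ 0))).comp D.toContinuousLinearMap)).congr_of_mem
    (fun t ht => ?_) ht
  ext g
  rw [add_apply, ContinuousLinearMap.intervalIntegral_apply
    (intervalIntegrable_of_continuousOn_Icc hforce ht)]
  exact hγ.momentum_eq_add_integral g ht

end IsGeodesic

/-- The second derivative of the right-invariant velocity `u(t) = γ'(t) ∘ φ(t)⁻¹` along a curve,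
pulled back by the diffeomorphism `φ(t) = Id + γ(t)`. -/
def eulerianD2 (γ : ℝ → H02) (t : ℝ) : L2 := pullbackD2 (D (γ t)) (D (velocity γ t))

namespace IsGeodesic

variable {γ : ℝ → H02} {t : ℝ}

lemma jac_smul_eulerianD2 (hγ : IsGeodesic γ) (ht : t ∈ Icc (0 : ℝ) 1) :
    jac (D (γ t)) • eulerianD2 γ t = dNonlinearity (D (γ t)) (D (velocity γ t)) :=
  jac_smul_pullbackD2 (hγ.isUnit_jac ht) _

lemma hasDerivWithinAt_inner_eulerianD2 (hγ : IsGeodesic γ) {δ : ℝ → L2} {δ' : L2}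
    (hδ : HasDerivWithinAt δ δ' (Icc 0 1) t) (ht : t ∈ Icc (0 : ℝ) 1)
    (h1 : ∀ s ∈ Icc (0 : ℝ) 1, primitive (δ s) 1 = 0)
    (h2 : ∀ s ∈ Icc (0 : ℝ) 1, primitive (toL2 (jac (D (γ s)) * primitive (δ s))) 1 = 0) :
    HasDerivWithinAt (fun s => inner ℝ (eulerianD2 γ s) (δ s))
      (inner ℝ (eulerianD2 γ t) δ' - 1 / 2 * inner ℝ (eulerianD2 γ t)
        (primitive (δ t) • jac (D (γ t)) • eulerianD2 γ t)) (Icc 0 1) t := by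
  set F := fun s => D (γ s)
  set X := D (velocity γ t)
  have hH : ∀ s ∈ Icc (0 : ℝ) 1, ∃ h, D h = jac (F s) • δ s + primitive (δ s) • F s := by
    intro s hs
    apply exists_D_eq
    · rw [primitive_jac_smul_add, ContinuousMap.mul_apply, h1 s hs, mul_zero]
    · rw [primitive_jac_smul_add, h2 s hs]
  choose! h hh using hH
  have hF := hγ.hasDerivWithinAt_D ht
  have hVδ : HasDerivWithinAt (fun s => primitive (δ s)) (primitive δ') (Icc 0 1) t :=
    primitive.hasFDerivAt.comp_hasDerivWithinAt t hδ
  have hDh := (((hasDerivWithinAt_jac hF).smul hδ).add (hVδ.smul hF)).congr_of_mem hh ht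
  obtain ⟨h', hh', hder⟩ := exists_hasDerivWithinAt_of_D ht hDh
  have hu : IsUnit (jac (F t)) := hγ.isUnit_jac ht
  have hmom := ((hγ.hasDerivWithinAt_momentum ht).clm_apply hder).congr_of_mem
    (f₁ := fun s => inner ℝ (eulerianD2 γ s) (δ s)) (fun s hs => by
      change _ = momentum (F s) _ (D (h s))
      rw [momentum_apply, hh s hs, dNonlinearity_jac_smul_add _ (hγ.isUnit_jac hs)]
      rfl) ht
  refine hmom.congr_deriv ?_
  have hrate : dNonlinearity (F t) (D h') = δ' +
      ((primitive X * jacInv (F t)) • δ t + primitive (δ t) • dNonlinearity (F t) X) := by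
    have hsplit : D h' = (jac (F t) • δ' + primitive δ' • F t) +
        (primitive X • δ t + primitive (δ t) • X) := by
      rw [hh']
      abel
    rw [hsplit, map_add, dNonlinearity_jac_smul_add _ hu, dNonlinearity_primitive_smul_add]
  have hVDh : primitive (D (h t)) • pullbackD2 (F t) X =
      primitive (δ t) • dNonlinearity (F t) X := by
    rw [hh t ht, primitive_jac_smul_add, mul_comm, mul_smul, jac_smul_pullbackD2 hu]
  change -force (F t) X (D (h t)) + momentum (F t) X (D h') = _
  rw [momentum_apply, hrate, force_apply, hVDh, hh t ht, dNonlinearity_jac_smul_add _ hu,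
    hγ.jac_smul_eulerianD2 ht, inner_add_right, inner_add_right, eulerianD2]
  ring

end IsGeodesic

end EulerianForm

section Multipliers

lemma primitive_pow_smul (u : L2) (n : ℕ) :
    (n + 1 : ℝ) • primitive (primitive u ^ n • u) = primitive u ^ (n + 1) := by
  induction n with
  | zero => simp
  | succ n ih =>
    have hprod := primitive_mul_primitive (primitive u ^ n • u) u
    have hpow : (n + 1 : ℝ) • primitive (primitive (primitive u ^ n • u) • u) =
        primitive (primitive u ^ (n + 1) • u) := by
      rw [← map_smul, ← smul_assoc, ih]
    rw [pow_succ _ (n + 1), ← ih, smul_mul_assoc, hprod, smul_smul, ← pow_succ', smul_add, hpow,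
      Nat.cast_succ, add_smul _ (1 : ℝ), one_smul, ih]

lemma primitive_toL2_one_apply_one : primitive (toL2 1) 1 = 1 := by
  have hint := primitive_toL2_apply 1 1
  rw [hint]
  change ∫ _ in (0 : ℝ)..1, (1 : ℝ) = 1
  norm_num

lemma primitive_toL2_jac_apply_one (f : H02) : primitive (toL2 (jac (D f))) 1 = 1 := by
  rw [jac, map_add, map_add, ContinuousMap.add_apply, f.primitive_toL2_primitive_D_one,
    primitive_toL2_one_apply_one, add_zero]

/-- The map `2 φ - 1`, where `φ(0) = 0`, `φ'(0) = 1` and `φ'' = F`. If `φ` is a diffeomorphism of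
`[0, 1]`, then it is orthogonal to the constants with respect to the density `φ'`. -/
def centeredMap (F : L2) : CI := (2 : ℝ) • primitive (toL2 (jac F)) - 1

variable (F : L2)

lemma primitive_toL2_jac_mul_centeredMap :
    primitive (toL2 (jac F * centeredMap F)) =
      primitive (toL2 (jac F)) ^ 2 - primitive (toL2 (jac F)) := by
  have hpow := primitive_pow_smul (toL2 (jac F)) 1
  rw [pow_one, Nat.cast_one, one_add_one_eq_two, ← map_smul, one_add_one_eq_two] at hpow
  rw [mul_comm, toL2_mul, centeredMap, sub_smul, one_smul, map_sub, smul_assoc, hpow]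

lemma inner_toL2_centeredMap {δ : L2} (hδ : primitive δ 1 = 0) :
    inner ℝ (toL2 (centeredMap F)) δ = -2 * primitive (toL2 (jac F * primitive δ)) 1 := by
  have hprod := congrArg (fun c : CI => c 1) (primitive_mul_primitive (toL2 (jac F)) δ)
  simp only [ContinuousMap.mul_apply, ContinuousMap.add_apply, hδ, mul_zero] at hprod
  rw [inner_toL2, centeredMap, sub_smul, one_smul, map_sub, ContinuousMap.sub_apply, hδ,
    mul_comm (jac F), toL2_mul, smul_assoc, map_smul, ContinuousMap.smul_apply, smul_eq_mul]
  linarith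

lemma inner_centeredMap_jac_mul_centeredMap (f : H02) :
    inner ℝ (toL2 (centeredMap (D f))) (toL2 (jac (D f) * centeredMap (D f))) = 1 / (3 : ℝ) := by
  set u := toL2 (jac (D f))
  have hone : primitive u 1 = 1 := primitive_toL2_jac_apply_one f
  have hsq := congrArg (fun c : CI => c 1) (primitive_pow_smul u 1)
  have hcube := congrArg (fun c : CI => c 1) (primitive_pow_smul u 2)
  simp only [ContinuousMap.smul_apply, ContinuousMap.pow_apply, smul_eq_mul, hone, one_pow,
    pow_one] at hsq hcube
  push_cast at hsq hcube
  rw [inner_toL2_centeredMap, primitive_toL2_jac_mul_centeredMap, mul_comm (jac (D f)),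
    toL2_mul, sub_smul, map_sub, ContinuousMap.sub_apply]
  · linarith
  · rw [primitive_toL2_jac_mul_centeredMap, ContinuousMap.sub_apply, ContinuousMap.pow_apply, hone,
      one_pow, sub_self]

/-- The part of `κ` of the form `φ' · u'' ∘ φ` with `u` vanishing to first order at `0` and `1`,
where `φ'' = F`. It is obtained by subtracting multiples of `φ'` and `φ' (2 φ - 1)`. -/
def constrainedPart (F κ : L2) : L2 :=
  κ - inner ℝ (toL2 1) κ • toL2 (jac F) -
    (3 * inner ℝ (toL2 (centeredMap F)) κ) • toL2 (jac F * centeredMap F)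

variable {F} (f : H02) (κ : L2)

lemma primitive_constrainedPart_apply_one : primitive (constrainedPart (D f) κ) 1 = 0 := by
  have hcentered : primitive (toL2 (jac (D f) * centeredMap (D f))) 1 = 0 := by
    rw [primitive_toL2_jac_mul_centeredMap, ContinuousMap.sub_apply, ContinuousMap.pow_apply,
      primitive_toL2_jac_apply_one, one_pow, sub_self]
  simp only [constrainedPart, map_sub, map_smul, ContinuousMap.sub_apply, ContinuousMap.smul_apply,
    smul_eq_mul, primitive_toL2_jac_apply_one, hcentered, ← primitive_apply_one]
  ring

lemma primitive_toL2_jac_mul_primitive_constrainedPart :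
    primitive (toL2 (jac (D f) * primitive (constrainedPart (D f) κ))) 1 = 0 := by
  have hjac : inner ℝ (toL2 (centeredMap (D f))) (toL2 (jac (D f))) = (0 : ℝ) := by
    rw [inner_toL2, ← toL2_mul, mul_comm, primitive_toL2_jac_mul_centeredMap,
      ContinuousMap.sub_apply, ContinuousMap.pow_apply, primitive_toL2_jac_apply_one, one_pow,
      sub_self]
  have hinner := inner_toL2_centeredMap (D f) (primitive_constrainedPart_apply_one f κ)
  simp only [constrainedPart, inner_sub_right, inner_smul_right, hjac,
    inner_centeredMap_jac_mul_centeredMap] at hinner ⊢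
  linarith

lemma inner_pullbackD2_toL2_jac (h : IsUnit (jac F)) (g : H02) :
    inner ℝ (pullbackD2 F (D g)) (toL2 (jac F)) = (0 : ℝ) := by
  rw [real_inner_comm, inner_toL2, jac_smul_pullbackD2 h, primitive_dNonlinearity h,
    ContinuousMap.mul_apply, H02.primitive_D_one, zero_mul]

lemma inner_pullbackD2_toL2_jac_mul_centeredMap (h : IsUnit (jac F)) (g : H02) :
    inner ℝ (pullbackD2 F (D g)) (toL2 (jac F * centeredMap F)) = (0 : ℝ) := by
  have hV : primitive (dNonlinearity F (D g)) 1 = 0 := by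
    rw [primitive_dNonlinearity h, ContinuousMap.mul_apply, H02.primitive_D_one, zero_mul]
  have hE : jac F * (primitive (D g) * jacInv F) = primitive (D g) := by
    rw [mul_left_comm, jac_mul_jacInv h, mul_one]
  rw [toL2_mul, ← inner_smul_comm, jac_smul_pullbackD2 h, real_inner_comm,
    inner_toL2_centeredMap _ hV, primitive_dNonlinearity h, hE,
    H02.primitive_toL2_primitive_D_one, mul_zero]

variable {S : Set ℝ} {t : ℝ}

lemma hasDerivWithinAt_centeredMap {F : ℝ → L2} {F' : L2} (hF : HasDerivWithinAt F F' S t) :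
    HasDerivWithinAt (fun s => centeredMap (F s)) ((2 : ℝ) • primitive (toL2 (primitive F'))) S t :=
  ((((primitive.comp toL2).hasFDerivAt.comp_hasDerivWithinAt t
    (hasDerivWithinAt_jac hF)).const_smul (2 : ℝ)).sub_const 1)

lemma hasDerivWithinAt_constrainedPart {F : ℝ → L2} {F' : L2} (hF : HasDerivWithinAt F F' S t) :
    HasDerivWithinAt (fun s => constrainedPart (F s) κ)
      (-(inner ℝ (toL2 1) κ • toL2 (primitive F')) -
        (3 * inner ℝ (toL2 (centeredMap (F t))) κ) •
          toL2 (primitive F' * centeredMap (F t) +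
            jac (F t) * (2 : ℝ) • primitive (toL2 (primitive F'))) -
        (6 * inner ℝ (toL2 (primitive (toL2 (primitive F')))) κ) •
          toL2 (jac (F t) * centeredMap (F t))) S t := by
  have hE := hasDerivWithinAt_jac hF
  have hL := hasDerivWithinAt_centeredMap hF
  have hLκ := (((toL2.hasFDerivAt.comp_hasDerivWithinAt t hL).inner ℝ
    (hasDerivWithinAt_const t S κ)).const_mul 3)
  have hEκ := (toL2.hasFDerivAt.comp_hasDerivWithinAt t hE).const_smul (inner ℝ (toL2 1) κ)
  have hEL := toL2.hasFDerivAt.comp_hasDerivWithinAt t (hE.mul hL)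
  refine ((hEκ.const_sub κ).sub (hLκ.smul hEL)).congr_deriv ?_
  simp only [Function.comp_apply, inner_zero_right, zero_add, map_smul, inner_smul_left,
    conj_trivial]
  module

end Multipliers

section EulerianEquation

lemma continuous_centeredMap : Continuous centeredMap := by
  have := continuous_jac
  unfold centeredMap
  fun_prop

/-- The Lagrange multiplier of the constraint `u'(1) = 0` in the geodesic equation, where `F = φ''`
and `X` is the second derivative of the velocity. -/
def slopeMultiplier (F X : L2) : ℝ :=
  1 / 2 * inner ℝ (pullbackD2 F X) (primitive (toL2 (jac F)) • jac F • pullbackD2 F X) -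
    inner ℝ (pullbackD2 F X) (toL2 (primitive X)) -
    1 / 2 * inner ℝ (pullbackD2 F X) (jac F • pullbackD2 F X)

/-- The Lagrange multiplier of the constraint `u(1) = 0` in the geodesic equation, where `F = φ''`
and `X` is the second derivative of the velocity. -/
def valueMultiplier (F X : L2) : ℝ :=
  3 / 2 * inner ℝ (pullbackD2 F X)
      (primitive (toL2 (jac F * centeredMap F)) • jac F • pullbackD2 F X) -
    3 * inner ℝ (pullbackD2 F X) (toL2 (primitive X * centeredMap F +
      jac F * (2 : ℝ) • primitive (toL2 (primitive X))))

/-- The time derivative of `u'' ∘ φ` along a geodesic, where `F = φ''` and `X` is the second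
derivative of the velocity. Unlike `u'' ∘ φ` itself it is continuous in space. -/
def eulerianRate (F X : L2) : CI :=
  (1 / 2 : ℝ) • primitiveMul (pullbackD2 F X) (jac F • pullbackD2 F X) +
    slopeMultiplier F X • 1 + valueMultiplier F X • centeredMap F

lemma inner_primitive_smul (u v κ : L2) :
    inner ℝ u (primitive κ • v) =
      inner ℝ u v * inner ℝ (toL2 1) κ - inner ℝ (toL2 (primitiveMul u v)) κ := by
  have hprod := congrArg (fun c : CI => c 1) (primitiveMul_mul_primitive u v κ)
  simp only [ContinuousMap.mul_apply, ContinuousMap.add_apply, primitiveMul_apply_one] at hprod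
  rw [inner_toL2 (primitiveMul u v), ← primitive_apply_one]
  linarith

section Continuity

variable {p : L2 × L2}

lemma continuousAt_slopeMultiplier (h : IsUnit (jac p.1)) :
    ContinuousAt (fun p : L2 × L2 => slopeMultiplier p.1 p.2) p := by
  have := continuous_jac
  have := continuousAt_pullbackD2 h
  unfold slopeMultiplier
  fun_prop

lemma continuousAt_valueMultiplier (h : IsUnit (jac p.1)) :
    ContinuousAt (fun p : L2 × L2 => valueMultiplier p.1 p.2) p := by
  have := continuous_jac
  have := continuous_centeredMap
  have := continuousAt_pullbackD2 h
  unfold valueMultiplier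
  fun_prop

lemma continuousAt_eulerianRate (h : IsUnit (jac p.1)) :
    ContinuousAt (fun p : L2 × L2 => eulerianRate p.1 p.2) p := by
  have := continuous_jac
  have := continuous_centeredMap
  have := continuousAt_pullbackD2 h
  have := continuousAt_slopeMultiplier h
  have := continuousAt_valueMultiplier h
  unfold eulerianRate
  fun_prop

end Continuity

namespace IsGeodesic

variable {γ : ℝ → H02} {t : ℝ}

lemma inner_eulerianD2_constrainedPart (hγ : IsGeodesic γ) (ht : t ∈ Icc (0 : ℝ) 1) (κ : L2) :
    inner ℝ (eulerianD2 γ t) (constrainedPart (D (γ t)) κ) = inner ℝ (eulerianD2 γ t) κ := by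
  rw [constrainedPart, inner_sub_right, inner_sub_right, inner_smul_right, inner_smul_right,
    eulerianD2, inner_pullbackD2_toL2_jac (hγ.isUnit_jac ht),
    inner_pullbackD2_toL2_jac_mul_centeredMap (hγ.isUnit_jac ht), mul_zero, mul_zero, sub_zero,
    sub_zero]

lemma hasDerivWithinAt_inner_eulerianD2_left (hγ : IsGeodesic γ) (ht : t ∈ Icc (0 : ℝ) 1)
    (κ : L2) :
    HasDerivWithinAt (fun s => inner ℝ (eulerianD2 γ s) κ)
      (inner ℝ (toL2 (eulerianRate (D (γ t)) (D (velocity γ t)))) κ) (Icc 0 1) t := by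
  have hu := hγ.isUnit_jac ht
  have hδ := hasDerivWithinAt_constrainedPart κ (hγ.hasDerivWithinAt_D ht)
  have hder := hγ.hasDerivWithinAt_inner_eulerianD2 hδ ht
    (fun s _ => primitive_constrainedPart_apply_one (γ s) κ)
    (fun s _ => primitive_toL2_jac_mul_primitive_constrainedPart (γ s) κ)
  refine (hder.congr_of_mem
    (fun s hs => (hγ.inner_eulerianD2_constrainedPart hs κ).symm) ht).congr_deriv ?_
  have hEL := inner_pullbackD2_toL2_jac_mul_centeredMap hu (velocity γ t)
  have hκ := inner_primitive_smul (eulerianD2 γ t) (jac (D (γ t)) • eulerianD2 γ t) κ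
  simp only [eulerianRate, map_add, map_smul, inner_add_left, inner_smul_left, conj_trivial]
  simp only [eulerianD2, constrainedPart, slopeMultiplier, valueMultiplier, map_add, map_sub,
    map_smul, sub_smul, smul_assoc, inner_sub_right, inner_neg_right, inner_smul_right, hEL] at hκ ⊢
  rw [hκ]
  ring

lemma continuousOn_eulerianRate (hγ : IsGeodesic γ) :
    ContinuousOn (fun t => eulerianRate (D (γ t)) (D (velocity γ t))) (Icc 0 1) :=
  hγ.continuousOn_comp_D fun _ => continuousAt_eulerianRate

lemma eulerianD2_eq_add_integral (hγ : IsGeodesic γ) (ht : t ∈ Icc (0 : ℝ) 1) :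
    eulerianD2 γ t = eulerianD2 γ 0 +
      toL2 (∫ s in (0 : ℝ)..t, eulerianRate (D (γ s)) (D (velocity γ s))) := by
  have hrate := hγ.continuousOn_eulerianRate
  refine ext_inner_right ℝ fun κ => ?_
  set ℓ : CI →L[ℝ] ℝ := ((innerSL ℝ).flip κ).comp toL2
  rw [eq_add_integral_of_hasDerivWithinAt
    (fun t ht => hγ.hasDerivWithinAt_inner_eulerianD2_left ht κ)
    (ℓ.continuous.comp_continuousOn hrate) ht, inner_add_left]
  congr 1
  exact ℓ.intervalIntegral_comp_comm (intervalIntegrable_of_continuousOn_Icc hrate ht)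

end IsGeodesic

end EulerianEquation

section InitialVelocity

lemma jac_zero : jac 0 = 1 := by rw [jac, map_zero, add_zero]

lemma pullbackD2_zero (X : L2) : pullbackD2 0 X = X := by
  simp only [pullbackD2, dNonlinearity_apply, jacInv, jac_zero, Ring.inverse_one, one_smul,
    smul_zero, sub_zero]

lemma nonlinearity_zero : nonlinearity 0 = 0 := smul_zero _

/-- The change of the second derivative of the Eulerian velocity between the times `0` and `t`,
along the trajectories of the flow. -/
def eulerianChange (γ : ℝ → H02) (t : ℝ) : CI :=
  ∫ s in (0 : ℝ)..t, eulerianRate (D (γ s)) (D (velocity γ s))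

/-- The derivative in space of the rate of change of `u_xx` along the trajectories, for a geodesic
whose initial velocity has the second derivative `v`. -/
def eulerianRateDensity (γ : ℝ → H02) (v : CI) (t : ℝ) : CI :=
  (1 / 2 : ℝ) • ((v + eulerianChange γ t) * (jac (D (γ t)) * (v + eulerianChange γ t))) +
    (2 * valueMultiplier (D (γ t)) (D (velocity γ t))) • jac (D (γ t))

lemma eulerianD2_zero {γ : ℝ → H02} (h0 : γ 0 = 0) : eulerianD2 γ 0 = D (velocity γ 0) := by
  rw [eulerianD2, h0, map_zero, pullbackD2_zero]

lemma ext_integral {c : ℝ → CI} {t : ℝ} (hc : ContinuousOn c (Icc 0 1))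
    (ht : t ∈ Icc (0 : ℝ) 1) (x : ℝ) :
    ext (∫ s in (0 : ℝ)..t, c s) x = ∫ s in (0 : ℝ)..t, ext (c s) x :=
  (ContinuousLinearMap.intervalIntegral_comp_comm
    (ContinuousMap.evalCLM ℝ (projIcc (0 : ℝ) 1 zero_le_one x))
    (intervalIntegrable_of_continuousOn_Icc hc ht)).symm

namespace IsGeodesic

variable {γ : ℝ → H02} {t : ℝ}

lemma continuousOn_jac (hγ : IsGeodesic γ) : ContinuousOn (fun t => jac (D (γ t))) (Icc 0 1) :=
  continuous_jac.comp_continuousOn hγ.continuousOn_D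

lemma continuousOn_eulerianChange (hγ : IsGeodesic γ) : ContinuousOn (eulerianChange γ) (Icc 0 1) :=
  continuousOn_integral hγ.continuousOn_eulerianRate

lemma dNonlinearity_velocity (hγ : IsGeodesic γ) (h0 : γ 0 = 0) (ht : t ∈ Icc (0 : ℝ) 1) :
    dNonlinearity (D (γ t)) (D (velocity γ t)) =
      jac (D (γ t)) • (D (velocity γ 0) + toL2 (eulerianChange γ t)) := by
  rw [← hγ.jac_smul_eulerianD2 ht, hγ.eulerianD2_eq_add_integral ht, eulerianD2_zero h0]
  rfl

lemma nonlinearity_eq_integral (hγ : IsGeodesic γ) (h0 : γ 0 = 0) (ht : t ∈ Icc (0 : ℝ) 1) :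
    nonlinearity (D (γ t)) =
      ∫ s in (0 : ℝ)..t, jac (D (γ s)) • (D (velocity γ 0) + toL2 (eulerianChange γ s)) := by
  have hE := hγ.continuousOn_jac
  have hT := hγ.continuousOn_eulerianChange
  have hint := eq_add_integral_of_hasDerivWithinAt
    (f' := fun s => jac (D (γ s)) • (D (velocity γ 0) + toL2 (eulerianChange γ s)))
    (fun s hs => (hasDerivWithinAt_nonlinearity (hγ.hasDerivWithinAt_D hs)
      (hγ.isUnit_jac hs)).congr_deriv (hγ.dNonlinearity_velocity h0 hs)) (by fun_prop) ht
  rwa [h0, map_zero, nonlinearity_zero, zero_add] at hint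

lemma nonlinearity_eq_integral_smul_add (hγ : IsGeodesic γ) (h0 : γ 0 = 0)
    (ht : t ∈ Icc (0 : ℝ) 1) :
    nonlinearity (D (γ t)) = (∫ s in (0 : ℝ)..t, jac (D (γ s))) • D (velocity γ 0) +
      toL2 (∫ s in (0 : ℝ)..t, jac (D (γ s)) * eulerianChange γ s) := by
  have hE := hγ.continuousOn_jac
  have hT := hγ.continuousOn_eulerianChange
  have hsmul : ∫ s in (0 : ℝ)..t, jac (D (γ s)) • D (velocity γ 0) =
      (∫ s in (0 : ℝ)..t, jac (D (γ s))) • D (velocity γ 0) :=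
    ContinuousLinearMap.intervalIntegral_comp_comm
      ((ContinuousLinearMap.lsmul ℝ CI).flip (D (velocity γ 0)))
      (intervalIntegrable_of_continuousOn_Icc hE ht)
  have htoL2 : ∫ s in (0 : ℝ)..t, jac (D (γ s)) • toL2 (eulerianChange γ s) =
      toL2 (∫ s in (0 : ℝ)..t, jac (D (γ s)) * eulerianChange γ s) := by
    simp only [← toL2_mul]
    exact ContinuousLinearMap.intervalIntegral_comp_comm toL2
      (intervalIntegrable_of_continuousOn_Icc (hE.mul hT) ht)
  simp only [hγ.nonlinearity_eq_integral h0 ht, smul_add]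
  rw [intervalIntegral.integral_add, hsmul, htoL2]
  · exact intervalIntegrable_of_continuousOn_Icc (by fun_prop) ht
  · exact intervalIntegrable_of_continuousOn_Icc (by fun_prop) ht

lemma integral_ext_jac_pos (hγ : IsGeodesic γ) {x : ℝ} (hx : x ∈ Icc (0 : ℝ) 1) :
    0 < ∫ t in (0 : ℝ)..1, ext (jac (D (γ t))) x := by
  have hcont : ContinuousOn (fun t => ext (jac (D (γ t))) x) (Icc 0 1) :=
    (ContinuousMap.evalCLM ℝ (projIcc (0 : ℝ) 1 zero_le_one x)).continuous.comp_continuousOn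
      hγ.continuousOn_jac
  refine intervalIntegral.intervalIntegral_pos_of_pos_on
    (intervalIntegrable_of_continuousOn_Icc hcont (right_mem_Icc.2 zero_le_one))
    (fun t ht => ?_) zero_lt_one
  exact mem_Diff02_iff.1 (hγ.mem t (Ioo_subset_Icc_self ht)) x hx

lemma isUnit_integral_jac (hγ : IsGeodesic γ) : IsUnit (∫ t in (0 : ℝ)..1, jac (D (γ t))) := by
  rw [ContinuousMap.isUnit_iff_forall_ne_zero]
  intro x
  rw [← ext_of_mem _ x.2, ext_integral hγ.continuousOn_jac (right_mem_Icc.2 zero_le_one)]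
  exact (hγ.integral_ext_jac_pos x.2).ne'

lemma exists_D_velocity_zero_eq_toL2 (hγ : IsGeodesic γ) (h0 : γ 0 = 0) {p : CI}
    (hp : nonlinearity (D (γ 1)) = toL2 p) :
    ∃ v : CI, D (velocity γ 0) = toL2 v ∧
      (∫ t in (0 : ℝ)..1, jac (D (γ t))) * v +
        ∫ t in (0 : ℝ)..1, jac (D (γ t)) * eulerianChange γ t = p := by
  have hint := hγ.nonlinearity_eq_integral_smul_add h0 (right_mem_Icc.2 zero_le_one)
  set β := ∫ t in (0 : ℝ)..1, jac (D (γ t))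
  set α := ∫ t in (0 : ℝ)..1, jac (D (γ t)) * eulerianChange γ t
  have hβ : IsUnit β := hγ.isUnit_integral_jac
  refine ⟨Ring.inverse β * (p - α), ?_, ?_⟩
  · rw [toL2_mul, map_sub, ← hp, hint, add_sub_cancel_right, smul_smul,
      Ring.inverse_mul_cancel _ hβ, one_smul]
  · rw [← mul_assoc, Ring.mul_inverse_cancel _ hβ, one_mul, sub_add_cancel]

variable {v : CI}

lemma jac_eq_one_add (hγ : IsGeodesic γ) (h0 : γ 0 = 0) (hv : D (velocity γ 0) = toL2 v)
    (ht : t ∈ Icc (0 : ℝ) 1) :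
    jac (D (γ t)) = 1 + primitive (toL2 (jac (D (γ t)) *
      ∫ s in (0 : ℝ)..t, jac (D (γ s)) * (v + eulerianChange γ s))) := by
  have hE := hγ.continuousOn_jac
  have hT := hγ.continuousOn_eulerianChange
  have hint : nonlinearity (D (γ t)) =
      toL2 (∫ s in (0 : ℝ)..t, jac (D (γ s)) * (v + eulerianChange γ s)) := by
    simp only [hγ.nonlinearity_eq_integral h0 ht, hv, ← map_add, ← toL2_mul]
    exact ContinuousLinearMap.intervalIntegral_comp_comm toL2
      (intervalIntegrable_of_continuousOn_Icc (by fun_prop) ht)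
  rw [toL2_mul, ← hint, nonlinearity, smul_smul, jac_mul_jacInv (hγ.isUnit_jac ht), one_smul, jac]

lemma continuousOn_valueMultiplier (hγ : IsGeodesic γ) :
    ContinuousOn (fun t => valueMultiplier (D (γ t)) (D (velocity γ t))) (Icc 0 1) :=
  hγ.continuousOn_comp_D fun _ => continuousAt_valueMultiplier

lemma continuousOn_eulerianRateDensity (hγ : IsGeodesic γ) (v : CI) :
    ContinuousOn (eulerianRateDensity γ v) (Icc 0 1) := by
  have hE := hγ.continuousOn_jac
  have hT := hγ.continuousOn_eulerianChange
  have hν := hγ.continuousOn_valueMultiplier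
  unfold eulerianRateDensity
  fun_prop

lemma eulerianRate_eq (hγ : IsGeodesic γ) (h0 : γ 0 = 0) (hv : D (velocity γ 0) = toL2 v)
    (ht : t ∈ Icc (0 : ℝ) 1) :
    eulerianRate (D (γ t)) (D (velocity γ t)) =
      (slopeMultiplier (D (γ t)) (D (velocity γ t)) -
        valueMultiplier (D (γ t)) (D (velocity γ t))) • 1 +
        primitive (toL2 (eulerianRateDensity γ v t)) := by
  have hw : pullbackD2 (D (γ t)) (D (velocity γ t)) = toL2 (v + eulerianChange γ t) := by
    have := hγ.eulerianD2_eq_add_integral ht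
    rwa [eulerianD2_zero h0, hv, ← map_add] at this
  have hB : primitiveMul (toL2 (v + eulerianChange γ t))
      (toL2 (jac (D (γ t)) * (v + eulerianChange γ t))) =
      primitive (toL2 ((v + eulerianChange γ t) * (jac (D (γ t)) * (v + eulerianChange γ t)))) := by
    rw [toL2_mul (v + eulerianChange γ t), primitive_smul]
  rw [eulerianRate, hw, ← toL2_mul, hB, eulerianRateDensity, centeredMap]
  simp only [map_add, map_smul]
  module

lemma exists_eulerianChange_eq (hγ : IsGeodesic γ) (h0 : γ 0 = 0)
    (hv : D (velocity γ 0) = toL2 v) (ht : t ∈ Icc (0 : ℝ) 1) :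
    ∃ k : ℝ, eulerianChange γ t =
      k • 1 + primitive (toL2 (∫ s in (0 : ℝ)..t, eulerianRateDensity γ v s)) := by
  have hσ := hγ.continuousOn_eulerianRateDensity v
  have hκ : ContinuousOn (fun t => slopeMultiplier (D (γ t)) (D (velocity γ t)) -
      valueMultiplier (D (γ t)) (D (velocity γ t))) (Icc 0 1) :=
    (hγ.continuousOn_comp_D fun _ => continuousAt_slopeMultiplier).sub
      hγ.continuousOn_valueMultiplier
  have hprim : ContinuousOn (fun t => primitive (toL2 (eulerianRateDensity γ v t))) (Icc 0 1) := by
    fun_prop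
  refine ⟨∫ s in (0 : ℝ)..t, (slopeMultiplier (D (γ s)) (D (velocity γ s)) -
    valueMultiplier (D (γ s)) (D (velocity γ s))), ?_⟩
  calc eulerianChange γ t
      = ∫ s in (0 : ℝ)..t, ((slopeMultiplier (D (γ s)) (D (velocity γ s)) -
          valueMultiplier (D (γ s)) (D (velocity γ s))) • (1 : CI) +
          primitive (toL2 (eulerianRateDensity γ v s))) := by
        refine intervalIntegral.integral_congr fun s hs => ?_
        rw [uIcc_of_le ht.1] at hs
        exact hγ.eulerianRate_eq h0 hv ⟨hs.1, hs.2.trans ht.2⟩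
    _ = _ := by
        rw [intervalIntegral.integral_add
          (intervalIntegrable_of_continuousOn_Icc (by fun_prop) ht)
          (intervalIntegrable_of_continuousOn_Icc hprim ht), intervalIntegral.integral_smul_const]
        congr 1
        exact ContinuousLinearMap.intervalIntegral_comp_comm (primitive.comp toL2)
          (intervalIntegrable_of_continuousOn_Icc hσ ht)

end IsGeodesic

end InitialVelocity

section ExchangeOfVariables

/-- `s` is the function of two variables `c`, given on `[0,1]²`, with the order of the variables
exchanged. -/
def IsSwap (c s : ℝ → CI) : Prop := ∀ (x : ℝ) (t : Icc (0 : ℝ) 1), s x t = ext (c t) x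

lemma exists_isSwap {c : ℝ → CI} (hc : ContinuousOn c (Icc 0 1)) :
    ∃ s, Continuous s ∧ IsSwap c s := by
  have hc' : Continuous fun t : Icc (0 : ℝ) 1 => c t :=
    continuousOn_iff_continuous_domRestrict.1 hc
  have hjoint : Continuous fun p : ℝ × Icc (0 : ℝ) 1 => ext (c p.2) p.1 :=
    (hc'.comp continuous_snd).eval (continuous_projIcc.comp continuous_fst)
  exact ⟨ContinuousMap.curry ⟨_, hjoint⟩, ContinuousMap.continuous _, fun _ _ => rfl⟩

lemma isSwap_const (c : CI) : IsSwap (fun _ => c) (fun x => ext c x • 1) := fun x t => by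
  simp

namespace IsSwap

variable {c d s u : ℝ → CI}

lemma mul (hc : IsSwap c s) (hd : IsSwap d u) : IsSwap (fun t => c t * d t) (fun x => s x * u x) :=
  fun x t => congrArg₂ (· * ·) (hc x t) (hd x t)

lemma add (hc : IsSwap c s) (hd : IsSwap d u) : IsSwap (fun t => c t + d t) (fun x => s x + u x) :=
  fun x t => congrArg₂ (· + ·) (hc x t) (hd x t)

lemma const_smul (hc : IsSwap c s) (k : ℝ) : IsSwap (fun t => k • c t) (fun x => k • s x) :=
  fun x t => congrArg (k * ·) (hc x t)

lemma smul (hc : IsSwap c s) (ν : CI) : IsSwap (fun t => ext ν t • c t) (fun x => ν * s x) :=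
  fun x t => congrArg₂ (· * ·) (ext_of_mem ν t.2).symm (hc x t)

lemma primitive (hs : IsSwap c s) (hc : ContinuousOn c (Icc 0 1)) :
    IsSwap (fun t => ∫ r in (0 : ℝ)..t, c r) (fun x => primitive (toL2 (s x))) := fun x t => by
  rw [primitive_toL2_apply, ext_integral hc t.2]
  refine intervalIntegral.integral_congr fun r hr => ?_
  rw [uIcc_of_le t.2.1] at hr
  have hr' : r ∈ Icc (0 : ℝ) 1 := ⟨hr.1, hr.2.trans t.2.2⟩
  exact (ext_of_mem (s x) hr').trans (hs x ⟨r, hr'⟩)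

lemma hasDerivWithinAt (hs : IsSwap c s) (hu : IsSwap d u) (hcont : Continuous u)
    (h : ∀ t ∈ Icc (0 : ℝ) 1, ∃ k : ℝ, c t = k • 1 + SobolevDiff.primitive (toL2 (d t)))
    {x : ℝ} (hx : x ∈ Icc (0 : ℝ) 1) : HasDerivWithinAt s (u x) (Icc 0 1) x := by
  have hint : ∀ x ∈ Icc (0 : ℝ) 1, s x = s 0 + ∫ y in (0 : ℝ)..x, u y := by
    intro x hx
    ext t
    obtain ⟨k, hk⟩ := h t t.2
    have hcomm : ∫ y in (0 : ℝ)..x, u y t = (∫ y in (0 : ℝ)..x, u y) t :=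
      ContinuousLinearMap.intervalIntegral_comp_comm (ContinuousMap.evalCLM ℝ t)
        (hcont.intervalIntegrable _ _)
    have hst : ∀ y ∈ Icc (0 : ℝ) 1, s y t = k + ∫ r in (0 : ℝ)..y, u r t := by
      intro y hy
      rw [hs, hk, ext_of_mem _ hy, ContinuousMap.add_apply, primitive_toL2_apply]
      simp [hu _ t]
    rw [ContinuousMap.add_apply, ← hcomm, hst x hx, hst 0 (by simp)]
    simp
  exact ((hasDerivWithinAt_integral hcont.continuousOn hx).const_add (s 0)).congr hint (hint x hx)

end IsSwap

end ExchangeOfVariables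

section SpatialEquation

/-- The equation of geodesics issuing from the identity, as an ordinary differential equation in the
space variable whose unknowns are functions of time: `e x` is `φ'(x)`, the sum `v x + τ x` is
`u_xx(φ(x))` with initial value `v x`, and `ν` is a Lagrange multiplier. The last field says that
`p` is the nonlinearity `φ'' / φ'` at the final time. -/
structure IsSpatialSolution (e τ : ℝ → CI) (v p : ℝ → ℝ) (ν : CI) : Prop where
  hasDerivWithinAt_jac : ∀ x ∈ Icc (0 : ℝ) 1,
    HasDerivWithinAt e (e x * primitive (toL2 (e x * (v x • 1 + τ x)))) (Icc 0 1) x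
  hasDerivWithinAt_change : ∀ x ∈ Icc (0 : ℝ) 1,
    HasDerivWithinAt τ (primitive (toL2
      ((1 / 2 : ℝ) • ((v x • 1 + τ x) * (e x * (v x • 1 + τ x))) + ν * e x))) (Icc 0 1) x
  integral_jac_ne_zero : ∀ x ∈ Icc (0 : ℝ) 1, primitive (toL2 (e x)) 1 ≠ 0
  nonlinearity_eq : ∀ x ∈ Icc (0 : ℝ) 1,
    primitive (toL2 (e x)) 1 * v x + primitive (toL2 (e x * τ x)) 1 = p x

theorem IsGeodesic.exists_isSpatialSolution {γ : ℝ → H02} (hγ : IsGeodesic γ) (h0 : γ 0 = 0)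
    {p : CI} (hp : nonlinearity (D (γ 1)) = toL2 p) :
    ∃ (e τ : ℝ → CI) (v ν : CI), D (velocity γ 0) = toL2 v ∧
      IsSpatialSolution e τ (ext v) (ext p) ν := by
  obtain ⟨v, hv, hvp⟩ := hγ.exists_D_velocity_zero_eq_toL2 h0 hp
  have hE := hγ.continuousOn_jac
  have hT := hγ.continuousOn_eulerianChange
  obtain ⟨e, hec, he⟩ := exists_isSwap hE
  obtain ⟨τ, hτc, hτ⟩ := exists_isSwap hT
  obtain ⟨ν, hν⟩ := exists_ext_eqOn (hγ.continuousOn_valueMultiplier.const_smul (2 : ℝ))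
  have hW : IsSwap (fun t => v + eulerianChange γ t) (fun x => ext v x • 1 + τ x) :=
    (isSwap_const v).add hτ
  have hWc : Continuous fun x => ext v x • (1 : CI) + τ x :=
    ((continuous_ext v).smul continuous_const).add hτc
  have hβ (x : ℝ) : primitive (toL2 (e x)) 1 = ext (∫ t in (0 : ℝ)..1, jac (D (γ t))) x :=
    he.primitive hE x 1
  have hα (x : ℝ) : primitive (toL2 (e x * τ x)) 1 =
      ext (∫ t in (0 : ℝ)..1, jac (D (γ t)) * eulerianChange γ t) x :=
    (he.mul hτ).primitive (hE.mul hT) x 1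
  have hσ : IsSwap (eulerianRateDensity γ v) fun x =>
      (1 / 2 : ℝ) • ((ext v x • 1 + τ x) * (e x * (ext v x • 1 + τ x))) + ν * e x := by
    intro x t
    rw [((hW.mul (he.mul hW)).const_smul _).add (he.smul ν) x t]
    simp only [hν t.2]
    rfl
  refine ⟨e, τ, v, ν, hv, fun x hx => ?_, fun x hx => ?_, fun x hx => ?_, fun x _ => ?_⟩
  · refine he.hasDerivWithinAt (he.mul ((he.mul hW).primitive (hE.mul (hT.const_add v))))
      (by fun_prop) (fun t ht => ⟨1, ?_⟩) hx
    rw [one_smul]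
    exact hγ.jac_eq_one_add h0 hv ht
  · exact hτ.hasDerivWithinAt (hσ.primitive (hγ.continuousOn_eulerianRateDensity v)) (by fun_prop)
      (fun t ht => hγ.exists_eulerianChange_eq h0 hv ht) hx
  · rw [hβ, ext_integral hE (right_mem_Icc.2 zero_le_one)]
    exact (hγ.integral_ext_jac_pos hx).ne'
  · rw [hβ, hα, ← hvp]
    rfl

end SpatialEquation

section Bootstrap

lemma contDiffOn_succ_of_hasDerivWithinAt {Y : Type*} [NormedAddCommGroup Y] [NormedSpace ℝ Y]
    {f f' : ℝ → Y} {s : Set ℝ} {m : ℕ} (hs : UniqueDiffOn ℝ s)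
    (h : ∀ x ∈ s, HasDerivWithinAt f (f' x) s x) (hf' : ContDiffOn ℝ m f' s) :
    ContDiffOn ℝ (m + 1 : ℕ) f s := by
  push_cast
  rw [contDiffOn_succ_iff_derivWithin hs]
  refine ⟨fun x hx => (h x hx).differentiableWithinAt, by simp, hf'.congr fun x hx => ?_⟩
  exact (h x hx).derivWithin (hs x hx)

section Primitive

variable {f : ℝ → CI} {s : Set ℝ} {k : WithTop ℕ∞}

lemma contDiffOn_primitive (hf : ContDiffOn ℝ k f s) :
    ContDiffOn ℝ k (fun x => primitive (toL2 (f x))) s :=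
  (primitive.comp toL2).contDiff.comp_contDiffOn hf

lemma contDiffOn_primitive_apply_one (hf : ContDiffOn ℝ k f s) :
    ContDiffOn ℝ k (fun x => primitive (toL2 (f x)) 1) s :=
  ((ContinuousMap.evalCLM ℝ (1 : Icc (0 : ℝ) 1)).comp
    (primitive.comp toL2)).contDiff.comp_contDiffOn hf

end Primitive

namespace IsSpatialSolution

variable {e τ : ℝ → CI} {v p : ℝ → ℝ} {ν : CI} {m : ℕ}

lemma initial_eq (h : IsSpatialSolution e τ v p ν) {x : ℝ} (hx : x ∈ Icc (0 : ℝ) 1) :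
    v x = (primitive (toL2 (e x)) 1)⁻¹ * (p x - primitive (toL2 (e x * τ x)) 1) := by
  rw [← h.nonlinearity_eq x hx, add_sub_cancel_right,
    inv_mul_cancel_left₀ (h.integral_jac_ne_zero x hx)]

lemma contDiffOn_integral_jac_inv (h : IsSpatialSolution e τ v p ν)
    (he : ContDiffOn ℝ m e (Icc 0 1)) :
    ContDiffOn ℝ m (fun x => (primitive (toL2 (e x)) 1)⁻¹) (Icc 0 1) :=
  (contDiffOn_primitive_apply_one he).inv h.integral_jac_ne_zero

lemma contDiffOn (h : IsSpatialSolution e τ v p ν) (hp : ContDiffOn ℝ m p (Icc 0 1)) :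
    ContDiffOn ℝ (m + 1 : ℕ) e (Icc 0 1) ∧ ContDiffOn ℝ (m + 1 : ℕ) τ (Icc 0 1) := by
  suffices H : ∀ j ≤ m + 1, ContDiffOn ℝ j e (Icc 0 1) ∧ ContDiffOn ℝ j τ (Icc 0 1) from
    H _ le_rfl
  intro j hj
  induction j with
  | zero =>
    simp only [Nat.cast_zero, contDiffOn_zero]
    exact ⟨fun x hx => (h.hasDerivWithinAt_jac x hx).continuousWithinAt,
      fun x hx => (h.hasDerivWithinAt_change x hx).continuousWithinAt⟩
  | succ j ih =>
    obtain ⟨he, hτ⟩ := ih (by omega)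
    have hpj : ContDiffOn ℝ j p (Icc 0 1) := hp.of_le (by exact_mod_cast (by omega : j ≤ m))
    have hv : ContDiffOn ℝ j v (Icc 0 1) :=
      ((h.contDiffOn_integral_jac_inv he).mul
        (hpj.sub (contDiffOn_primitive_apply_one (he.mul hτ)))).congr fun x hx => h.initial_eq hx
    have hW : ContDiffOn ℝ j (fun x => v x • (1 : CI) + τ x) (Icc 0 1) :=
      (hv.smul contDiffOn_const).add hτ
    have hσ := ((hW.mul (he.mul hW)).const_smul (1 / 2 : ℝ)).add
      ((contDiffOn_const (c := ν)).mul he)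
    have hunique : UniqueDiffOn ℝ (Icc (0 : ℝ) 1) := uniqueDiffOn_Icc zero_lt_one
    exact ⟨contDiffOn_succ_of_hasDerivWithinAt hunique h.hasDerivWithinAt_jac
        (he.mul (contDiffOn_primitive (he.mul hW))),
      contDiffOn_succ_of_hasDerivWithinAt hunique h.hasDerivWithinAt_change
        (contDiffOn_primitive hσ)⟩

lemma memH_initial (h : IsSpatialSolution e τ v p ν) (hp : ContDiffOn ℝ m p (Icc 0 1))
    (hpH : MemH (m + 1) p) : MemH (m + 1) v := by
  obtain ⟨he, hτ⟩ := h.contDiffOn hp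
  have hα := memH_of_contDiffOn (contDiffOn_primitive_apply_one (he.mul hτ))
  refine (MemH.contDiffOn_mul (h.contDiffOn_integral_jac_inv he)
    (hpH.add (hα.smul (-1)))).congr (ae_eq_of_eqOn_Icc fun x hx => ?_)
  rw [h.initial_eq hx, sub_eq_add_neg, ← neg_one_smul ℝ (primitive (toL2 (e x * τ x)) 1)]
  rfl

end IsSpatialSolution

lemma exists_eq_toL2_of_memH {m : ℕ} {F : L2} (hF : MemH (m + 1) F) :
    ∃ c : CI, ContDiffOn ℝ m (ext c) (Icc 0 1) ∧ F = toL2 c := by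
  obtain ⟨g, hg, hFg⟩ := hF.exists_contDiffOn
  obtain ⟨c, hc⟩ := exists_ext_eqOn hg.continuousOn
  exact ⟨c, hg.congr hc, eq_toL2_of_ae_eq (hFg.trans (ae_eq_of_eqOn_Icc hc).symm)⟩

lemma contDiffOn_ext_jacInv_toL2 {m : ℕ} {c : CI} (hu : IsUnit (jac (toL2 c)))
    (hc : ContDiffOn ℝ m (ext c) (Icc 0 1)) :
    ContDiffOn ℝ (m + 1 : ℕ) (ext (jacInv (toL2 c))) (Icc 0 1) := by
  have hjac : ContDiffOn ℝ (m + 1 : ℕ) (ext (jac (toL2 c))) (Icc 0 1) :=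
    contDiffOn_succ_of_hasDerivWithinAt (uniqueDiffOn_Icc zero_lt_one)
      (fun x hx => (hasDerivWithinAt_ext_primitive_toL2 c hx).const_add 1) hc
  exact (hjac.inv fun x _ => right_ne_zero_of_mul_eq_one (ext_jacInv_mul_ext_jac hu x)).congr
    fun x _ => ext_jacInv hu x

lemma exists_nonlinearity_eq_toL2 {m : ℕ} {F : L2} (hu : IsUnit (jac F)) (hF : MemH (m + 1) F) :
    ∃ p : CI, nonlinearity F = toL2 p ∧ ContDiffOn ℝ m (ext p) (Icc 0 1) ∧
      MemH (m + 1) (ext p) := by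
  obtain ⟨c, hc, rfl⟩ := exists_eq_toL2_of_memH hF
  have hR := contDiffOn_ext_jacInv_toL2 hu hc
  exact ⟨jacInv (toL2 c) * c, (toL2_mul _ _).symm,
    (hR.of_le (by exact_mod_cast m.le_succ)).mul hc,
    MemH.contDiffOn_mul hR (hF.congr (coeFn_toL2 c))⟩

theorem IsGeodesic.memH_velocity_zero {m : ℕ} {γ : ℝ → H02} (hγ : IsGeodesic γ) (h0 : γ 0 = 0)
    (hreg : MemH (m + 3) (γ 1)) : MemH (m + 3) (velocity γ 0) := by
  obtain ⟨p, hp, hpC, hpH⟩ := exists_nonlinearity_eq_toL2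
    (hγ.isUnit_jac (right_mem_Icc.2 zero_le_one)) (H02.memH_iff_D.1 hreg)
  obtain ⟨e, τ, v, ν, hv, hsol⟩ := hγ.exists_isSpatialSolution h0 hp
  rw [H02.memH_iff_D (m := m + 1), hv]
  exact (hsol.memH_initial hpC hpH).congr (coeFn_toL2 v).symm

lemma memH_toMap_iff {n : ℕ} {f : H02} : MemH n (toMap f) ↔ MemH n f := by
  have hid : MemH n (fun x : ℝ => x) := memH_of_contDiffOn contDiffOn_id
  refine ⟨fun hf => ?_, fun hf => hid.add hf⟩
  convert hf.add (hid.smul (-1)) using 1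
  funext x
  simp [toMap]

end Bootstrap

end

end SobolevDiff

theorem mainTheorem7 (n : ℕ) (hn : 3 ≤ n)
    (φ₁ : SobolevDiff.H02) (hφ₁ : φ₁ ∈ SobolevDiff.Diff02)
    (hreg : SobolevDiff.MemH n (SobolevDiff.toMap φ₁))
    (γ : ℝ → SobolevDiff.H02) (hγ : SobolevDiff.IsGeodesic γ)
    (h0 : SobolevDiff.toMap (γ 0) = id)
    (h1 : SobolevDiff.toMap (γ 1) = SobolevDiff.toMap φ₁) :
    SobolevDiff.MemH n (SobolevDiff.velocity γ 0) := by
  obtain ⟨m, rfl⟩ := Nat.exists_eq_add_of_le' hn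
  have hγ0 : γ 0 = 0 :=
    SobolevDiff.toMap_injective (h0.trans (funext fun x => (add_zero x).symm))
  exact hγ.memH_velocity_zero hγ0 (SobolevDiff.memH_toMap_iff.1 (h1 ▸ hreg))
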